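/- **($b$-th moments.)** *Parameters.* Let $\lambda_u,h,r_c,\sigma^2,\theta,a>0$, $c\in\mathbb R$ and, for $s\in\{l,n\}$ ($l$ = LoS, $n$ = NLoS), $\alpha_s>2$, $\epsilon_s\ge 0$, $\rho_s,\eta_s>0$ and integers $m_s\ge 1$; let $b\ge 1$ be an integer. Put $$P_l(r)=\frac{1}{1+a\exp\left(-c\left(\frac{180}{\pi}\arctan\frac hr-a\right)\right)},\qquad P_n=1-P_l .$$ *Network.* Interfering cluster centres form a homogeneous Poisson point process of density $\lambda_u$ in $\mathbb R^2$; a reference cluster is centred at the origin. Over each centre hovers a UAV at altitude $h$. Each cluster has one active user, uniform in the disc of radius $r_c$ about the centre, these displacements being i.i.d. and independent of the centres. Given all locations, every link is independently LoS with probability $P_l(\text{its horizontal length})$ and otherwise NLoS. Let $R_u$ be the (three-dimensional) distance between the reference user and the reference UAV, $R_i$ that between the $i$-th interfering user and its own UAV, and $D_i$ that between the $i$-th interfering user and the reference UAV; let $s_o,e_i,j_i\in\{l,n\}$ be the states of the three corresponding links. With independent fading gains, $G^{(s)}\sim\mathrm{Gamma}(\text{shape }m_s,\text{ scale }1/m_s)$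 on a link in state $s$, $$\mathrm{SINR}=\frac{\rho_{s_o}\eta_{s_o}G_oR_u^{-(1-\epsilon_{s_o})\alpha_{s_o}}}{I+\sigma^2},\qquad I=\sum_i\rho_{e_i}\eta_{j_i}G_iR_i^{\alpha_{e_i}\epsilon_{e_i}}D_i^{-\alpha_{j_i}} .$$ Let $P_s(\theta)$ denote the conditional probability of $\mathrm{SINR}>\theta$ given all locations and all link states (that is, over the fading), let $P_{s,l}(\theta)=\mathbf 1\{s_o=l\}P_s(\theta)$ and $P_{s,n}(\theta)=\mathbf 1\{s_o=n\}P_s(\theta)$, and let $M_b(\theta)=\mathbb E[P_s(\theta)^b]$, $M_{b,q}(\theta)=\mathbb E[P_{s,q}(\theta)^b]$ for $q\in\{l,n\}$. *Explicit formula.* Let $\beta_2(m)=(m!)^{-1/m}$, $f_{R_u}(r)=2r/r_c^2$ for $h\le r\le\sqrt{r_c^2+h^2}$ (and $0$ otherwise), $g_{q,k}(r)=k\,\beta_2(m_q)m_q\theta r^{(1-\epsilon_q)\alpha_q}(\rho_q\eta_q)^{-1}$, $$f(e,j,g,R,D)=\left(\frac{m_j}{m_j+g\rho_e\eta_jR^{\alpha_e\epsilon_e}D^{-\alpha_j}}\right)^{m_j},$$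 $$\mathcal L(g_1,\dots,g_b)=e^{-(g_1+\dots+g_b)\sigma^2}\exp\left(-2\pi\lambda_u\sum_{e,j\in\{l,n\}}\int_h^\infty\int_h^{\sqrt{h^2+r_c^2}}\left[1-\prod_{i=1}^bf(e,j,g_i,r,z)\right]z\,P_e(\sqrt{r^2-h^2})P_j(\sqrt{z^2-h^2})f_{R_u}(r)\,dr\,dz\right),$$ $$F_{b,q}(\theta)=\sum_{k_1=1}^{m_q}\cdots\sum_{k_b=1}^{m_q}\binom{m_q}{k_1}\cdots\binom{m_q}{k_b}(-1)^{k_1+\dots+k_b+b}\int_h^{\sqrt{r_c^2+h^2}}P_q(\sqrt{r^2-h^2})\,\mathcal L(g_{q,k_1}(r),\dots,g_{q,k_b}(r))f_{R_u}(r)\,dr .$$ *Claim.* $M_b(\theta)=M_{b,l}(\theta)+M_{b,n}(\theta)$, and $M_{b,q}(\theta)\approx F_{b,q}(\theta)$ for $q\in\{l,n\}$, in the following sense. The approximation is the replacement of $\bar F_m(x)=\mathbb P(G>x)$, $G\sim\mathrm{Gamma}(m,1/m)$, by $\tilde F_m(x)=1-(1-e^{-\beta_2(m)mx})^m$: 1.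 $F_{b,q}(\theta)$ is exactly the $b$-th moment of the resulting approximate conditional success probability $$\tilde P_{s,q}(\theta)=\mathbf 1\{s_o=q\}\sum_{k=1}^{m_q}\binom{m_q}{k}(-1)^{k+1}e^{-g_{q,k}(R_u)\sigma^2}\prod_if(e_i,j_i,g_{q,k}(R_u),R_i,D_i);$$ 2. $M_{b,q}(\theta)\le F_{b,q}(\theta)\le M_{b,q}(\theta)+b\,\delta_{m_q}$, where $\delta_m=\sup_{x\ge0}|\tilde F_m(x)-\bar F_m(x)|$ (in particular equality holds if $m_q=1$). -/

import Mathlib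

open MeasureTheory ProbabilityTheory Set
open scoped ENNReal NNReal

namespace UavUplink

/-- The horizontal plane. -/
abbrev Plane : Type := EuclideanSpace ℝ (Fin 2)

/-- A link is either line-of-sight or non-line-of-sight. -/
inductive LinkState : Type
  | los
  | nlos
  deriving DecidableEq

instance : Fintype LinkState := ⟨{.los, .nlos}, by rintro (_ | _) <;> simp⟩

/-- Parameters of the network. A subscript `l` or `n` in the mathematics is a value of
`LinkState` here. -/
structure Params where
  /-- density of the cluster centres, equal to the density of the active users -/
  lam : ℝ
  /-- altitude of the UAVs -/
  h : ℝ
  /-- cluster radius -/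
  rc : ℝ
  /-- first environment parameter of the line-of-sight probability -/
  envA : ℝ
  /-- second environment parameter of the line-of-sight probability -/
  envB : ℝ
  /-- noise power -/
  noise : ℝ
  /-- path-loss exponents -/
  alpha : LinkState → ℝ
  /-- power-control compensation factors -/
  eps : LinkState → ℝ
  /-- power-control parameters -/
  rho : LinkState → ℝ
  /-- mean additional losses -/
  eta : LinkState → ℝ
  /-- integer Nakagami shape parameters -/
  m : LinkState → ℕ

/-- The admissible ranges of the parameters. -/
structure Params.Admissible (p : Params) : Prop where
  lam_pos : 0 < p.lam
  h_pos : 0 < p.h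
  rc_pos : 0 < p.rc
  envA_pos : 0 < p.envA
  noise_pos : 0 < p.noise
  two_lt_alpha : ∀ s, 2 < p.alpha s
  eps_nonneg : ∀ s, 0 ≤ p.eps s
  rho_pos : ∀ s, 0 < p.rho s
  eta_pos : ∀ s, 0 < p.eta s
  m_pos : ∀ s, 1 ≤ p.m s

noncomputable section

/-- Probability that a link of horizontal length `r` is line-of-sight. -/
def losProb (p : Params) (r : ℝ) : ℝ :=
  1 / (1 + p.envA *
    Real.exp (-p.envB * (180 / Real.pi * Real.arctan (p.h / r) - p.envA)))

/-- Probability that a link of horizontal length `r` is in the given state. -/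
def linkProb (p : Params) : LinkState → ℝ → ℝ
  | .los, r => losProb p r
  | .nlos, r => 1 - losProb p r

/-! ### The random network -/

/-- Number of points of the family `X` that lie in `A`. -/
def pointCount {Ω : Type*} (X : ℕ → Ω → Plane) (A : Set Plane) (ω : Ω) : ℝ≥0∞ :=
  ∑' i, A.indicator (fun _ => (1 : ℝ≥0∞)) (X i ω)

/-- `X` enumerates the points of a homogeneous Poisson point process of density `lam > 0`
(which almost surely has infinitely many points). -/
structure IsPoissonProcess {Ω : Type*} [MeasurableSpace Ω] (lam : ℝ) (X : ℕ → Ω → Plane)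
    (μ : Measure Ω) : Prop where
  measurable : ∀ i, Measurable (X i)
  count_law : ∀ A : Set Plane, MeasurableSet A → volume A ≠ ∞ →
    HasLaw (pointCount X A)
      ((poissonMeasure (ENNReal.ofReal lam * volume A).toNNReal).map
        (fun n : ℕ => (n : ℝ≥0∞))) μ
  count_indep : ∀ (n : ℕ) (A : Fin n → Set Plane), (∀ k, MeasurableSet (A k)) →
    Pairwise (fun k l => Disjoint (A k) (A l)) →
    iIndepFun (fun k => pointCount X (A k)) μ

/-- The data attached to a cluster: the displacement of its active user from the cluster centre,
and two numbers in `[0, 1]` that decide the states of the links of this user with its cluster UAV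
and with the reference UAV. -/
abbrev Mark : Type := Plane × ℝ × ℝ

/-- The user is uniform in the disc of radius `rc`; the deciding numbers are uniform on `[0, 1]`;
the three are independent. -/
def markLaw (p : Params) : Measure Mark :=
  (cond volume (Metric.closedBall (0 : Plane) p.rc)).prod
    ((volume.restrict (Icc (0 : ℝ) 1)).prod (volume.restrict (Icc (0 : ℝ) 1)))

/-- A realization of the network: the centres of the interfering clusters, indexed by `ℕ`, and the
marks of all clusters, where the index `none` is the reference cluster and `some i` is the
`i`-th interfering cluster. The reference cluster is centred at the origin. -/
structure Realization where
  centre : ℕ → Plane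
  mark : Option ℕ → Mark

/-- The random network: Poisson centres with independent, identically distributed marks. -/
structure IsNetwork {Ω : Type*} [MeasurableSpace Ω] (p : Params) (X : ℕ → Ω → Plane)
    (Y : Option ℕ → Ω → Mark) (μ : Measure Ω) : Prop where
  poisson : IsPoissonProcess p.lam X μ
  mark_law : ∀ i, HasLaw (Y i) (markLaw p) μ
  mark_indep : iIndepFun Y μ
  centre_mark_indep : IndepFun (fun ω i => X i ω) (fun ω i => Y i ω) μ

/-- Three-dimensional distance to a UAV from a user at horizontal displacement `v`. -/
def dist3 (p : Params) (v : Plane) : ℝ := Real.sqrt (‖v‖ ^ 2 + p.h ^ 2)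

/-- State of a link with horizontal displacement `v`, decided by the number `u`: for `u` uniform
on `[0, 1]` the link is line-of-sight with probability `losProb p ‖v‖`. -/
def linkState (p : Params) (v : Plane) (u : ℝ) : LinkState :=
  if u ≤ losProb p ‖v‖ then .los else .nlos

namespace Realization

/-- Distance between the user of cluster `i` and its cluster UAV. -/
def R (p : Params) (x : Realization) (i : Option ℕ) : ℝ := dist3 p (x.mark i).1

/-- State of the link between the user of cluster `i` and its cluster UAV. -/
def ownState (p : Params) (x : Realization) (i : Option ℕ) : LinkState :=
  linkState p (x.mark i).1 (x.mark i).2.1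

/-- Distance between the `i`-th interfering user and the reference UAV. -/
def D (p : Params) (x : Realization) (i : ℕ) : ℝ :=
  dist3 p (x.centre i + (x.mark (some i)).1)

/-- State of the link between the `i`-th interfering user and the reference UAV. -/
def refState (p : Params) (x : Realization) (i : ℕ) : LinkState :=
  linkState p (x.centre i + (x.mark (some i)).1) (x.mark (some i)).2.2

end Realization

/-! ### Fading, interference and success probability -/

/-- Fading gains of the links to the reference UAV: `G (i, s)` is the gain of the user of cluster
`i` if its link to the reference UAV is in state `s`. -/
abbrev Gains : Type := Option ℕ × LinkState → ℝ

/-- The gains are independent, and Gamma distributed with shape `m s` and scale `1 / m s`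
(that is, rate `m s`). -/
def gainLaw (p : Params) : Measure Gains :=
  Measure.infinitePi fun k : Option ℕ × LinkState => gammaMeasure (p.m k.2) (p.m k.2)

/-- Transmit power of a user at distance `r` from its cluster UAV, with a link in state `e`. -/
def transmitPower (p : Params) (e : LinkState) (r : ℝ) : ℝ :=
  p.rho e * r ^ (p.alpha e * p.eps e)

/-- Received power, at distance `d` over a link in state `j` with gain `g`, of a signal sent with
power `q`. -/
def receivedPower (p : Params) (q : ℝ) (j : LinkState) (g d : ℝ) : ℝ :=
  q * p.eta j * g * d ^ (-p.alpha j)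

/-- Interference at the reference UAV. -/
def interference (p : Params) (x : Realization) (G : Gains) : ℝ≥0∞ :=
  ∑' i : ℕ, ENNReal.ofReal
    (receivedPower p (transmitPower p (x.ownState p (some i)) (x.R p (some i)))
      (x.refState p i) (G (some i, x.refState p i)) (x.D p i))

/-- Signal-to-interference-plus-noise ratio at the reference UAV. -/
def sinr (p : Params) (x : Realization) (G : Gains) : ℝ≥0∞ :=
  ENNReal.ofReal
    (receivedPower p (transmitPower p (x.ownState p none) (x.R p none))
      (x.ownState p none) (G (none, x.ownState p none)) (x.R p none)) /
    (interference p x G + ENNReal.ofReal p.noise)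

/-- Conditional success probability: the probability, over the fading, of `SINR > θ` given the
realization of the network. -/
def condSuccess (p : Params) (θ : ℝ) (x : Realization) : ℝ :=
  (gainLaw p).real {G | ENNReal.ofReal θ < sinr p x G}

/-- Part of the conditional success probability for the reference link being in state `s`. -/
def condSuccessOn (p : Params) (s : LinkState) (θ : ℝ) (x : Realization) : ℝ :=
  if x.ownState p none = s then condSuccess p θ x else 0

section Moments

variable {Ω : Type*} [MeasurableSpace Ω]

/-- The `b`-th moment of the conditional success probability. -/
def moment (p : Params) (b : ℕ) (θ : ℝ) (X : ℕ → Ω → Plane) (Y : Option ℕ → Ω → Mark)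
    (μ : Measure Ω) : ℝ :=
  ∫ ω, condSuccess p θ ⟨fun i => X i ω, fun i => Y i ω⟩ ^ b ∂μ

/-- The `b`-th moment of the part for the reference link being in state `s`. -/
def momentOn (p : Params) (s : LinkState) (b : ℕ) (θ : ℝ) (X : ℕ → Ω → Plane)
    (Y : Option ℕ → Ω → Mark) (μ : Measure Ω) : ℝ :=
  ∫ ω, condSuccessOn p s θ ⟨fun i => X i ω, fun i => Y i ω⟩ ^ b ∂μ

end Moments

/-! ### The approximation of the conditional success probability -/

/-- `β₂(m) = (m!) ^ (-1 / m)`. -/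
def beta2 (m : ℕ) : ℝ := (m.factorial : ℝ) ^ (-(1 / (m : ℝ)))

/-- Complementary distribution function of a gain with shape `m` and scale `1 / m`. -/
def gammaTail (m : ℕ) (x : ℝ) : ℝ := (gammaMeasure m m).real (Ioi x)

/-- The approximation of `gammaTail` obtained from the bound on the incomplete Gamma function. -/
def gammaTailApprox (m : ℕ) (x : ℝ) : ℝ := 1 - (1 - Real.exp (-(beta2 m * m * x))) ^ m

/-- Uniform error of that approximation on `[0, ∞)`. -/
def gammaTailError (m : ℕ) : ℝ := ⨆ x : ℝ≥0, |gammaTailApprox m x - gammaTail m x|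

/-- `g_{s,k}(r) = k β₂(m_s) m_s θ r^{(1 - ε_s) α_s} (ρ_s η_s)⁻¹`. -/
def gCoeff (p : Params) (s : LinkState) (θ : ℝ) (k : ℕ) (r : ℝ) : ℝ :=
  k * beta2 (p.m s) * p.m s * θ * r ^ ((1 - p.eps s) * p.alpha s) * (p.rho s * p.eta s)⁻¹

/-- `f(e, j, g, R, D) = (m_j / (m_j + g ρ_e η_j R^{α_e ε_e} D^{-α_j}))^{m_j}`. -/
def fFactor (p : Params) (e j : LinkState) (g R D : ℝ) : ℝ :=
  ((p.m j : ℝ) /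
    (p.m j + g * p.rho e * p.eta j * R ^ (p.alpha e * p.eps e) * D ^ (-p.alpha j))) ^ p.m j

/-- The approximate conditional success probability for the reference link being in state `s`.
The factors of the infinite product lie in `(0, 1]`, so it is the infimum of the finite
products. -/
def approxSuccessOn (p : Params) (s : LinkState) (θ : ℝ) (x : Realization) : ℝ :=
  if x.ownState p none = s then
    ∑ k ∈ Finset.Icc 1 (p.m s), ((p.m s).choose k : ℝ) * (-1) ^ (k + 1) *
      Real.exp (-(gCoeff p s θ k (x.R p none) * p.noise)) *
      ∏' i : ℕ, fFactor p (x.ownState p (some i)) (x.refState p i)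
        (gCoeff p s θ k (x.R p none)) (x.R p (some i)) (x.D p i)
  else 0

/-! ### The explicit formula -/

/-- Density `f_{R_u}` of the distance between a user and its cluster UAV. -/
def distDensity (p : Params) (r : ℝ) : ℝ :=
  if p.h ≤ r ∧ r ≤ Real.sqrt (p.rc ^ 2 + p.h ^ 2) then 2 * r / p.rc ^ 2 else 0

/-- The joint Laplace-type term `𝓛(g_1, …, g_b)`. -/
def laplaceTerm (p : Params) {b : ℕ} (g : Fin b → ℝ) : ℝ :=
  Real.exp (-((∑ i, g i) * p.noise)) *
    Real.exp (-2 * Real.pi * p.lam * ∑ e : LinkState, ∑ j : LinkState,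
      ∫ z in Ioi p.h, ∫ r in p.h..Real.sqrt (p.h ^ 2 + p.rc ^ 2),
        (1 - ∏ i, fFactor p e j (g i) r z) * z *
          linkProb p e (Real.sqrt (r ^ 2 - p.h ^ 2)) *
          linkProb p j (Real.sqrt (z ^ 2 - p.h ^ 2)) * distDensity p r)

/-- The explicit approximation of the `b`-th moment for the reference link being in state `s`. -/
def momentFormula (p : Params) (s : LinkState) (b : ℕ) (θ : ℝ) : ℝ :=
  ∑ k ∈ Fintype.piFinset (fun _ : Fin b => Finset.Icc 1 (p.m s)),
    (∏ i, ((p.m s).choose (k i) : ℝ)) * (-1) ^ ((∑ i, k i) + b) *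
      ∫ r in p.h..Real.sqrt (p.rc ^ 2 + p.h ^ 2),
        linkProb p s (Real.sqrt (r ^ 2 - p.h ^ 2)) *
          laplaceTerm p (fun i => gCoeff p s θ (k i) r) * distDensity p r

end

end UavUplink

namespace UavUplink

/-! Given all locations and link states, success means that the reference gain exceeds a threshold
that is affine in the interference `I`. The reference gain is independent of `I`, so the conditional
success probability is the fading mean of the Gamma tail at this random threshold
(`condSuccess_eq_integral`). The approximate tail is a binomial combination of exponentials. The
mean of each `exp (-g I)` is a product of Gamma Laplace transforms, which are the factors `f`. Hence
the approximate success probability is the fading mean of the approximate tail at the same threshold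
(`approxSuccessOn_eq_integral`).

Exactness of the formula: the `b`-th power of the approximation expands over tuples `k`. Each term
is an indicator, a noise factor, and a product over the interferers (`approxSuccessOn_pow`). Given
the reference mark, its mean is a Laplace functional of an independently marked Poisson process.
This is computed by integrating out the marks and then applying the unmarked functional
`IsPoissonProcess.lintegral_expNeg`. Translation invariance of Lebesgue measure replaces cluster
centres by user positions. Polar coordinates seen from altitude `h` then give the double integral in
`𝓛` (`ofReal_laplaceTerm`), which is finite because the path-loss exponents exceed the dimension 2.

Bounds: the Gamma tail lies below its approximation (`gammaTail_le_gammaTailApprox`), because the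
two laws have the same mass and their densities cross at most once. The single crossing is Jensen's
inequality for powers. Averaging over the fading gives `P ≤ P̃ ≤ P + δ` and `P̃ ≤ 1` pointwise, and
taking `b`-th powers costs at most a factor `b` in the error.

Infinite products and Laplace transforms are carried as `expNeg` of sums in `[0, ∞]`. There every
sum converges, so infinite interference needs no exclusion. -/

open Filter Topology

/-! ### Exponentials of sums in `[0, ∞]`, and independence -/

/-- The function `t ↦ exp (-t)` on `[0, ∞]`, with value `0` at `∞`. -/
noncomputable def expNeg (t : ℝ≥0∞) : ℝ≥0∞ := EReal.exp (-(t : EReal))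

/-- The inverse `v ↦ -log v` of `expNeg`, for `v ≤ 1`. -/
noncomputable def negLog (v : ℝ≥0∞) : ℝ≥0∞ := (-ENNReal.log v).toENNReal

lemma continuous_expNeg : Continuous expNeg :=
  ENNReal.continuous_exp.comp (continuous_neg.comp continuous_coe_ennreal_ereal)

lemma measurable_expNeg : Measurable expNeg := continuous_expNeg.measurable

lemma measurable_negLog : Measurable negLog :=
  measurable_ereal_toENNReal.comp (ENNReal.measurable_log.neg)

lemma expNeg_negLog {v : ℝ≥0∞} (hv : v ≤ 1) : expNeg (negLog v) = v := by
  have h : (0 : EReal) ≤ -ENNReal.log v := by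
    simpa using EReal.neg_le_neg_iff.2 (ENNReal.log_le_zero_iff.2 hv)
  rw [expNeg, negLog, EReal.coe_toENNReal h, neg_neg, ENNReal.exp_log]

lemma expNeg_le_one (t : ℝ≥0∞) : expNeg t ≤ 1 := by
  rw [expNeg, EReal.exp_le_one_iff]
  simpa using EReal.neg_le_neg_iff.2 (EReal.coe_ennreal_nonneg t)

lemma expNeg_ne_top (t : ℝ≥0∞) : expNeg t ≠ ∞ :=
  ((expNeg_le_one t).trans_lt ENNReal.one_lt_top).ne

@[simp] lemma expNeg_zero : expNeg 0 = 1 := by simp [expNeg]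

@[simp] lemma expNeg_top : expNeg ∞ = 0 := by simp [expNeg]

lemma expNeg_ofReal {x : ℝ} (hx : 0 ≤ x) :
    expNeg (ENNReal.ofReal x) = ENNReal.ofReal (Real.exp (-x)) := by
  rw [expNeg, EReal.coe_ennreal_ofReal, max_eq_left hx, ← EReal.coe_neg, EReal.exp_coe]

lemma expNeg_of_ne_top {t : ℝ≥0∞} (ht : t ≠ ∞) :
    expNeg t = ENNReal.ofReal (Real.exp (-t.toReal)) := by
  rw [← expNeg_ofReal ENNReal.toReal_nonneg, ENNReal.ofReal_toReal ht]

lemma expNeg_add (s t : ℝ≥0∞) : expNeg (s + t) = expNeg s * expNeg t := by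
  rcases eq_or_ne s ∞ with rfl | hs
  · simp
  rcases eq_or_ne t ∞ with rfl | ht
  · simp
  rw [expNeg_of_ne_top hs, expNeg_of_ne_top ht, expNeg_of_ne_top (by finiteness),
    ENNReal.toReal_add hs ht, ← ENNReal.ofReal_mul (Real.exp_nonneg _), ← Real.exp_add, neg_add]

lemma expNeg_sum {ι : Type*} (s : Finset ι) (f : ι → ℝ≥0∞) :
    expNeg (∑ i ∈ s, f i) = ∏ i ∈ s, expNeg (f i) := by
  classical
  induction s using Finset.induction_on with
  | empty => simp
  | insert a s ha ih => rw [Finset.sum_insert ha, Finset.prod_insert ha, expNeg_add, ih]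

lemma antitone_expNeg : Antitone expNeg := fun s t h => by
  rw [expNeg, expNeg, EReal.exp_le_exp_iff, EReal.neg_le_neg_iff]
  exact_mod_cast h

/-- Continuity of `expNeg` carries the unconditional convergence of the sum over to the product. A
sum equal to `∞` is allowed and gives the product `0`. -/
lemma hasProd_expNeg {ι : Type*} (f : ι → ℝ≥0∞) :
    HasProd (fun i => (expNeg (f i)).toReal) (expNeg (∑' i, f i)).toReal := by
  have h : HasSum f (∑' i, f i) := ENNReal.summable.hasSum
  have h1 := ((ENNReal.tendsto_toReal (expNeg_ne_top (∑' i, f i))).comp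
    ((continuous_expNeg.tendsto _).comp h))
  refine h1.congr fun s => ?_
  simp [expNeg_sum, ENNReal.toReal_prod]

lemma tprod_eq_expNeg_tsum {ι : Type*} (c : ι → ℝ) (h0 : ∀ i, 0 ≤ c i) (h1 : ∀ i, c i ≤ 1) :
    ∏' i, c i = (expNeg (∑' i, negLog (ENNReal.ofReal (c i)))).toReal := by
  rw [← (hasProd_expNeg _).tprod_eq]
  congr 1 with i
  rw [expNeg_negLog (by simpa using h1 i), ENNReal.toReal_ofReal (h0 i)]

lemma tendsto_expNeg_sum_range (f : ℕ → ℝ≥0∞) :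
    Tendsto (fun n => expNeg (∑ i ∈ Finset.range n, f i)) atTop (𝓝 (expNeg (∑' i, f i))) :=
  (continuous_expNeg.tendsto _).comp (ENNReal.tendsto_nat_tsum f)

/-- Convergence of Laplace functionals along a converging sequence of exponents. -/
lemma tendsto_lintegral_expNeg {Ω : Type*} [MeasurableSpace Ω] {μ : Measure Ω}
    [IsFiniteMeasure μ] {S : ℕ → Ω → ℝ≥0∞} {S' : Ω → ℝ≥0∞} (hS : ∀ n, Measurable (S n))
    (h : ∀ ω, Tendsto (fun n => S n ω) atTop (𝓝 (S' ω))) :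
    Tendsto (fun n => ∫⁻ ω, expNeg (S n ω) ∂μ) atTop (𝓝 (∫⁻ ω, expNeg (S' ω) ∂μ)) := by
  refine tendsto_lintegral_of_dominated_convergence (fun _ => 1)
    (fun n => measurable_expNeg.comp (hS n)) (fun n => ae_of_all _ fun ω => expNeg_le_one _)
    (by simp) (ae_of_all _ fun ω => (continuous_expNeg.tendsto _).comp (h ω))

/-- The Laplace transform of a countable sum of independent variables. -/
lemma lintegral_expNeg_tsum {Ω E : Type*} [MeasurableSpace Ω] [MeasurableSpace E]
    {μ : Measure Ω} [IsProbabilityMeasure μ] {Z : ℕ → Ω → E} (hZ : ∀ i, Measurable (Z i))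
    (hind : iIndepFun Z μ) {f : ℕ → E → ℝ≥0∞} (hf : ∀ i, Measurable (f i)) :
    ∫⁻ ω, expNeg (∑' i, f i (Z i ω)) ∂μ =
      expNeg (∑' i, negLog (∫⁻ ω, expNeg (f i (Z i ω)) ∂μ)) := by
  -- Independence handles finite partial sums. The limit on both sides follows by dominated
  -- convergence and continuity.
  have hfin (n : ℕ) : ∫⁻ ω, expNeg (∑ i ∈ Finset.range n, f i (Z i ω)) ∂μ =
      expNeg (∑ i ∈ Finset.range n, negLog (∫⁻ ω, expNeg (f i (Z i ω)) ∂μ)) := by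
    have hle (i : ℕ) : ∫⁻ ω, expNeg (f i (Z i ω)) ∂μ ≤ 1 := by
      calc _ ≤ ∫⁻ _, 1 ∂μ := lintegral_mono fun ω => expNeg_le_one _
        _ = 1 := by simp
    have hi : iIndepFun (fun i ω => expNeg (f i (Z i ω))) μ :=
      hind.comp (fun i z => expNeg (f i z)) fun i => measurable_expNeg.comp (hf i)
    simp_rw [expNeg_sum, expNeg_negLog (hle _)]
    have := lintegral_prod_eq_prod_lintegral_of_indepFun (Finset.range n)
      (fun i ω => expNeg (f i (Z i ω))) hi
      (fun i => measurable_expNeg.comp ((hf i).comp (hZ i)))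
    simpa using this
  refine tendsto_nhds_unique (tendsto_lintegral_expNeg
    (S := fun n ω => ∑ i ∈ Finset.range n, f i (Z i ω))
    (fun n => Finset.measurable_sum _ fun i _ => (hf i).comp (hZ i))
    fun ω => ENNReal.tendsto_nat_tsum _) ?_
  simp_rw [hfin]
  exact tendsto_expNeg_sum_range _

/-- Disjoint subfamilies of an independent family are independent. -/
lemma indepFun_of_disjoint_of_iIndepFun {Ω ι : Type*} [MeasurableSpace Ω] {μ : Measure Ω}
    {β : ι → Type*} [∀ i, MeasurableSpace (β i)] {f : ∀ i, Ω → β i} (hf : ∀ i, Measurable (f i))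
    (h : iIndepFun f μ) {S T : Set ι} (hST : Disjoint S T) :
    IndepFun (fun ω (i : S) => f i ω) (fun ω (i : T) => f i ω) μ := by
  have key := indep_iSup_of_disjoint (fun i => (hf i).comap_le) h hST
  have hc (U : Set ι) : MeasurableSpace.comap (fun ω (i : U) => f i ω) MeasurableSpace.pi ≤
      ⨆ i ∈ U, MeasurableSpace.comap (f i) inferInstance := by
    rw [MeasurableSpace.pi, MeasurableSpace.comap_iSup]
    refine iSup_le fun i => ?_
    rw [MeasurableSpace.comap_comp]
    exact le_iSup₂_of_le i.1 i.2 le_rfl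
  exact indep_of_indep_of_le_left (indep_of_indep_of_le_right key (hc T)) (hc S)

/-! ### The Laplace functional of a Poisson process -/

/-- This is the generating function `E[v ^ N] = exp (-r (1 - v))` at `v = exp (-c)`. The value `c =
∞` is included as `v = 0`, since `∞ * 0 = 0` matches `0 ^ 0 = 1`. -/
lemma lintegral_expNeg_poissonMeasure (r : ℝ≥0) (c : ℝ≥0∞) :
    ∫⁻ n : ℕ, expNeg (c * n) ∂(poissonMeasure r) = expNeg (r * (1 - expNeg c)) := by
  obtain ⟨v, hv⟩ : ∃ v : ℝ≥0, expNeg c = v := ⟨_, (ENNReal.coe_toNNReal (expNeg_ne_top c)).symm⟩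
  have hv1 : (v : ℝ) ≤ 1 := by
    have := expNeg_le_one c
    rw [hv] at this
    exact_mod_cast this
  have hn (n : ℕ) : expNeg (c * n) = ENNReal.ofReal ((v : ℝ) ^ n) := by
    have := expNeg_sum (Finset.range n) (fun _ => c)
    rw [Finset.sum_const, Finset.card_range, nsmul_eq_mul, Finset.prod_const, Finset.card_range,
      mul_comm, hv] at this
    rw [this, ENNReal.ofReal_pow v.coe_nonneg, ENNReal.ofReal_coe_nnreal]
  have hr : (r : ℝ≥0∞) * (1 - expNeg c) = ENNReal.ofReal (r * (1 - v)) := by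
    rw [ENNReal.ofReal_mul r.coe_nonneg, ENNReal.ofReal_sub _ v.coe_nonneg, hv]
    simp
  have hs : HasSum (fun n : ℕ => Real.exp (-r) * (r : ℝ) ^ n / n.factorial * (v : ℝ) ^ n)
      (Real.exp (-(r * (1 - v)))) := by
    have h1 : HasSum (fun n : ℕ => (n.factorial : ℝ)⁻¹ • ((r * v : ℝ)) ^ n)
        (Real.exp (r * v)) := by
      rw [Real.exp_eq_exp_ℝ]
      exact NormedSpace.exp_series_hasSum_exp' (𝕂 := ℝ) (𝔸 := ℝ) _
    have h2 := h1.mul_left (Real.exp (-r))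
    rw [← Real.exp_add] at h2
    have h3 : -(r * (1 - v) : ℝ) = -r + r * v := by ring
    rw [h3]
    have h4 : (fun n : ℕ => Real.exp (-r) * (r : ℝ) ^ n / n.factorial * (v : ℝ) ^ n) =
        fun n : ℕ => Real.exp (-r) * ((n.factorial : ℝ)⁻¹ • ((r * v : ℝ)) ^ n) := by
      ext n
      rw [smul_eq_mul, mul_pow]
      ring
    rw [h4]
    exact h2
  rw [hr, expNeg_ofReal (mul_nonneg r.coe_nonneg (by linarith)), poissonMeasure,
    lintegral_sum_measure, ← hs.tsum_eq, ENNReal.ofReal_tsum_of_nonneg (fun n => by positivity) hs.summable]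
  congr 1 with n
  rw [lintegral_smul_measure, lintegral_dirac, hn, ENNReal.ofReal_mul (by positivity), smul_eq_mul]

variable {Ω : Type*} [MeasurableSpace Ω] {μ : Measure Ω} {lam : ℝ} {X : ℕ → Ω → Plane}

lemma IsPoissonProcess.measurable_pointCount (hX : IsPoissonProcess lam X μ) {A : Set Plane}
    (hA : MeasurableSet A) : Measurable (pointCount X A) :=
  Measurable.tsum fun i => (measurable_const.indicator hA).comp (hX.measurable i)

lemma IsPoissonProcess.lintegral_expNeg_pointCount (hX : IsPoissonProcess lam X μ) {A : Set Plane}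
    (hA : MeasurableSet A) (hA' : volume A ≠ ∞) (c : ℝ≥0∞) :
    ∫⁻ ω, expNeg (c * pointCount X A ω) ∂μ =
      expNeg (ENNReal.ofReal lam * (volume A * (1 - expNeg c))) := by
  have hm : Measurable fun t : ℝ≥0∞ => expNeg (c * t) :=
    measurable_expNeg.comp (measurable_const.mul measurable_id)
  rw [(hX.count_law A hA hA').lintegral_comp (f := fun t => expNeg (c * t)) hm.aemeasurable,
    lintegral_map hm (measurable_of_countable _), lintegral_expNeg_poissonMeasure,
    ENNReal.coe_toNNReal (by finiteness), mul_assoc]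

/-- The Laplace functional of a Poisson process at a simple function of bounded support. -/
lemma IsPoissonProcess.lintegral_expNeg_simpleFunc [IsProbabilityMeasure μ]
    (hX : IsPoissonProcess lam X μ) (g : SimpleFunc Plane ℝ≥0∞)
    {B : Set Plane} (hB : MeasurableSet B) (hB' : volume B ≠ ∞) :
    ∫⁻ ω, expNeg (∑' i, B.indicator g (X i ω)) ∂μ =
      expNeg (ENNReal.ofReal lam * ∫⁻ x, (1 - expNeg (B.indicator g x))) := by
  classical
  let n := g.range.card
  let e : Fin n ≃ g.range := g.range.equivFin.symm
  -- Level sets of distinct values are disjoint, so their counts are independent. Cutting with `B`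
  -- makes their volumes finite, as `count_law` requires.
  let A : Fin n → Set Plane := fun k => g ⁻¹' {(e k : ℝ≥0∞)} ∩ B
  have hA (k : Fin n) : MeasurableSet (A k) := (g.measurableSet_fiber _).inter hB
  have hA' (k : Fin n) : volume (A k) ≠ ∞ := measure_ne_top_of_subset inter_subset_right hB'
  have hdisj : Pairwise fun k l => Disjoint (A k) (A l) := fun k l hkl => by
    refine Set.disjoint_left.2 fun x hx hx' => hkl (e.injective (Subtype.ext ?_))
    exact (hx.1 : g x = e k).symm.trans hx'.1
  -- Used for the identity, in the sum over points, and for `1 - expNeg`, in the integral. Both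
  -- vanish at `0`, which accounts for the points outside `B`.
  have hsum (F : ℝ≥0∞ → ℝ≥0∞) (hF : F 0 = 0) (x : Plane) :
      F (B.indicator g x) = ∑ k, F (e k) * (A k).indicator (fun _ => 1) x := by
    by_cases hx : x ∈ B
    · let k₀ : Fin n := e.symm ⟨g x, g.mem_range_self x⟩
      have hk₀ : (e k₀ : ℝ≥0∞) = g x := by simp [k₀]
      rw [Finset.sum_eq_single k₀]
      · have : x ∈ A k₀ := ⟨hk₀.symm, hx⟩
        simp [this, hx, hk₀]
      · intro k _ hk
        have : x ∉ A k := fun h => hk (e.injective (Subtype.ext ((h.1 : g x = e k).symm.trans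
          hk₀.symm)))
        simp [this]
      · simp
    · have : ∀ k, x ∉ A k := fun k h => hx h.2
      simp [this, hx, hF]
  have h1 (ω : Ω) : ∑' i, B.indicator g (X i ω) = ∑ k, (e k : ℝ≥0∞) * pointCount X (A k) ω := by
    simp_rw [pointCount, ← ENNReal.tsum_mul_left]
    rw [← Summable.tsum_finsetSum fun k _ => ENNReal.summable]
    exact tsum_congr fun i => hsum id rfl _
  have h2 : ∫⁻ x, (1 - expNeg (B.indicator g x)) =
      ∑ k, volume (A k) * (1 - expNeg (e k)) := by
    simp_rw [hsum (fun t => 1 - expNeg t) (by simp)]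
    rw [lintegral_finsetSum (f := fun k x => (1 - expNeg (e k)) * (A k).indicator (fun _ => 1) x) _
      fun k _ => measurable_const.mul (measurable_const.indicator (hA k))]
    refine Finset.sum_congr rfl fun k _ => ?_
    rw [lintegral_const_mul _ (measurable_const.indicator (hA k)), lintegral_indicator_const (hA k),
      one_mul, mul_comm]
  have hm (k : Fin n) : Measurable fun t : ℝ≥0∞ => expNeg ((e k : ℝ≥0∞) * t) :=
    measurable_expNeg.comp (measurable_const.mul measurable_id)
  have hi : iIndepFun (fun k ω => expNeg ((e k : ℝ≥0∞) * pointCount X (A k) ω)) μ :=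
    (hX.count_indep n A hA hdisj).comp _ hm
  have h3 := lintegral_prod_eq_prod_lintegral_of_indepFun Finset.univ _ hi
    fun k => (hm k).comp (hX.measurable_pointCount (hA k))
  simp_rw [h1, expNeg_sum, h2, Finset.mul_sum, expNeg_sum]
  rw [h3]
  exact Finset.prod_congr rfl fun k _ => hX.lintegral_expNeg_pointCount (hA k) (hA' k) _

/-- The Laplace functional of a Poisson process. -/
theorem IsPoissonProcess.lintegral_expNeg [IsProbabilityMeasure μ]
    (hX : IsPoissonProcess lam X μ) {φ : Plane → ℝ≥0∞} (hφ : Measurable φ) :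
    ∫⁻ ω, expNeg (∑' i, φ (X i ω)) ∂μ =
      expNeg (ENNReal.ofReal lam * ∫⁻ x, (1 - expNeg (φ x))) := by
  let B : ℕ → Set Plane := fun n => Metric.closedBall 0 n
  let S : ℕ → Plane → ℝ≥0∞ := fun n => (B n).indicator (SimpleFunc.eapprox φ n)
  have hBm (n : ℕ) : MeasurableSet (B n) := measurableSet_closedBall
  have hSm (n : ℕ) : Measurable (S n) := (SimpleFunc.measurable _).indicator (hBm n)
  have hmono : Monotone S := fun n k hnk x => by
    have hB : B n ⊆ B k := Metric.closedBall_subset_closedBall (by exact_mod_cast hnk)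
    refine (indicator_le_indicator_of_subset hB (fun _ => zero_le) x).trans ?_
    exact indicator_le_indicator (SimpleFunc.monotone_eapprox φ hnk x)
  have hlim (x : Plane) : Tendsto (fun n => S n x) atTop (𝓝 (φ x)) := by
    refine (SimpleFunc.tendsto_eapprox hφ x).congr' ?_
    obtain ⟨N, hN⟩ := exists_nat_ge ‖x‖
    filter_upwards [eventually_ge_atTop N] with n hn
    have : x ∈ B n := by
      simp only [B, mem_closedBall_zero_iff]
      exact hN.trans (by exact_mod_cast hn)
    simp [S, this]
  have hsup (x : Plane) : ⨆ n, S n x = φ x :=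
    tendsto_nhds_unique (tendsto_atTop_iSup fun n k h => hmono h x) (hlim x)
  have hleft : Tendsto (fun n => ∫⁻ ω, expNeg (∑' i, S n (X i ω)) ∂μ) atTop
      (𝓝 (∫⁻ ω, expNeg (∑' i, φ (X i ω)) ∂μ)) := by
    refine tendsto_lintegral_expNeg
      (fun n => Measurable.tsum fun i => (hSm n).comp (hX.measurable i)) fun ω => ?_
    -- Monotone convergence for the counting measure.
    have h : ∑' i, φ (X i ω) = ⨆ n, ∑' i, S n (X i ω) := by
      simp_rw [← hsup]
      simp_rw [← lintegral_count]
      rw [lintegral_iSup (f := fun n i => S n (X i ω)) (fun n => measurable_of_countable _)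
        fun n k h i => hmono h _]
    rw [h]
    exact tendsto_atTop_iSup fun n k h => ENNReal.tsum_le_tsum fun i => hmono h _
  have hright : Tendsto (fun n => expNeg (ENNReal.ofReal lam * ∫⁻ x, (1 - expNeg (S n x)))) atTop
      (𝓝 (expNeg (ENNReal.ofReal lam * ∫⁻ x, (1 - expNeg (φ x))))) := by
    refine (continuous_expNeg.tendsto _).comp (ENNReal.Tendsto.const_mul ?_
      (Or.inr ENNReal.ofReal_ne_top))
    -- The plane has infinite volume, so domination by a constant is unavailable. However, `1 -
    -- expNeg (S n x)` increases with `n`.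
    refine lintegral_tendsto_of_tendsto_of_monotone
      (fun n => (measurable_const.sub (measurable_expNeg.comp (hSm n))).aemeasurable)
      (ae_of_all _ fun x n k h => tsub_le_tsub_left (antitone_expNeg (hmono h x)) _)
      (ae_of_all _ fun x => ?_)
    exact ENNReal.Tendsto.sub tendsto_const_nhds ((continuous_expNeg.tendsto _).comp (hlim x))
      (Or.inl ENNReal.one_ne_top)
  refine tendsto_nhds_unique hleft (hright.congr fun n => ?_)
  exact (hX.lintegral_expNeg_simpleFunc (SimpleFunc.eapprox φ n) (hBm n)
    measure_closedBall_lt_top.ne).symm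

/-! ### Gamma distributed gains -/

lemma isProbabilityMeasure_gamma_nat {m : ℕ} (hm : 1 ≤ m) :
    IsProbabilityMeasure (gammaMeasure m m) :=
  isProbabilityMeasure_gammaMeasure (by positivity) (by positivity)

/-- The Laplace transform of a gain of unit mean. -/
lemma lintegral_expNeg_gammaMeasure {m : ℕ} (hm : 1 ≤ m) {s : ℝ} (hs : 0 ≤ s) :
    ∫⁻ g, expNeg (ENNReal.ofReal (s * g)) ∂(gammaMeasure m m) =
      ENNReal.ofReal (((m : ℝ) / (m + s)) ^ m) := by
  have hm0 : (0 : ℝ) < m := by positivity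
  have hmeas : Measurable fun g : ℝ => expNeg (ENNReal.ofReal (s * g)) :=
    measurable_expNeg.comp (by fun_prop)
  have hpdf : Measurable (gammaPDF m m) := (measurable_gammaPDFReal m m).ennreal_ofReal
  rw [gammaMeasure, lintegral_withDensity_eq_lintegral_mul _ hpdf hmeas]
  -- Exponential tilting: multiplying the density of rate `m` by `exp (-s x)` gives a multiple of
  -- the density of rate `m + s`, whose mass is one.
  have h (x : ℝ) : (gammaPDF m m * fun g => expNeg (ENNReal.ofReal (s * g))) x =
      ENNReal.ofReal (((m : ℝ) / (m + s)) ^ m) * gammaPDF m (m + s) x := by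
    rcases lt_or_ge x 0 with hx | hx
    · simp [gammaPDF_of_neg hx]
    · have hsx := mul_nonneg hs hx
      have hms : (0 : ℝ) < m + s := by positivity
      rw [Pi.mul_apply, expNeg_ofReal hsx, gammaPDF_of_nonneg hx, gammaPDF_of_nonneg hx,
        ← ENNReal.ofReal_mul (by positivity), ← ENNReal.ofReal_mul (by positivity),
        Real.rpow_natCast, Real.rpow_natCast, div_pow]
      congr 1
      have : Real.exp (-((m + s) * x)) = Real.exp (-(m * x)) * Real.exp (-(s * x)) := by
        rw [← Real.exp_add]
        congr 1
        ring
      rw [this]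
      field_simp
  simp_rw [h]
  rw [lintegral_const_mul (f := gammaPDF m (m + s)) _
      (measurable_gammaPDFReal _ _).ennreal_ofReal,
    lintegral_gammaPDF_eq_one hm0 (by positivity), mul_one]

/-! ### The bound on the incomplete Gamma function -/

/-- Exhibits `(1 - exp (-u)) / u` as the mean of `exp (-u t)` for `t` uniform on `[0, 1]`, so that
Jensen's inequality applies to it. -/
lemma integral_exp_neg_mul {u : ℝ} (hu : 0 < u) :
    ∫ t in (0 : ℝ)..1, Real.exp (-(u * t)) = (1 - Real.exp (-u)) / u := by
  have hd (t : ℝ) : HasDerivAt (fun t => -Real.exp (-(u * t)) / u) (Real.exp (-(u * t))) t := by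
    have := (((hasDerivAt_id t).const_mul u).fun_neg.exp.fun_neg).div_const u
    refine this.congr_deriv ?_
    simp only [id]
    field_simp
  rw [intervalIntegral.integral_eq_sub_of_hasDerivAt (fun t _ => hd t)
    (by apply Continuous.intervalIntegrable; fun_prop)]
  simp
  ring

/-- `(1 - exp (-u)) / u`, raised to the power `1 / u`, increases with `u`. -/
lemma rpow_one_sub_exp_neg_div_le {u v : ℝ} (hu : 0 < u) (huv : u ≤ v) :
    ((1 - Real.exp (-u)) / u) ^ (v / u) ≤ (1 - Real.exp (-v)) / v := by
  have hv : 0 < v := hu.trans_le huv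
  have : IsProbabilityMeasure (volume.restrict (Ioc (0 : ℝ) 1)) := ⟨by simp⟩
  have hc (w : ℝ) : Integrable (fun t => Real.exp (-(w * t))) (volume.restrict (Ioc (0 : ℝ) 1)) :=
    (Continuous.integrableOn_Ioc (by fun_prop))
  have hp (t : ℝ) : Real.exp (-(u * t)) ^ (v / u) = Real.exp (-(v * t)) := by
    rw [← Real.exp_mul]
    congr 1
    field_simp
  -- Jensen's inequality for the power `v / u ≥ 1`, which sends `exp (-u t)` to `exp (-v t)`.
  have h := (convexOn_rpow (p := v / u) ((one_le_div hu).2 huv)).map_integral_le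
    (μ := volume.restrict (Ioc (0 : ℝ) 1)) (f := fun t => Real.exp (-(u * t)))
    (fun x _ => (Real.continuousAt_rpow_const x _ (Or.inr (by positivity))).continuousWithinAt)
    isClosed_Ici (ae_of_all _ fun t => (Real.exp_nonneg _)) (hc u)
    (by simpa only [Function.comp_def, hp] using hc v)
  simp_rw [hp] at h
  rwa [← intervalIntegral.integral_of_le zero_le_one, ← intervalIntegral.integral_of_le zero_le_one,
    integral_exp_neg_mul hu, integral_exp_neg_mul hv] at h

lemma beta2_pos (m : ℕ) : 0 < beta2 m := Real.rpow_pos_of_pos (by positivity) _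

lemma beta2_pow {m : ℕ} (hm : 1 ≤ m) : beta2 m ^ m = (m.factorial : ℝ)⁻¹ := by
  have : (m : ℝ) ≠ 0 := by positivity
  rw [beta2, ← Real.rpow_natCast, ← Real.rpow_mul (by positivity), neg_mul, one_div,
    inv_mul_cancel₀ this, Real.rpow_neg_one]

lemma gammaTailApprox_nonneg (m : ℕ) {x : ℝ} (hx : 0 ≤ x) : 0 ≤ gammaTailApprox m x := by
  have h1 : Real.exp (-(beta2 m * m * x)) ≤ 1 := by
    have := beta2_pos m
    exact Real.exp_le_one_iff.2 (by simpa using by positivity)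
  have := Real.exp_nonneg (-(beta2 m * m * x))
  exact sub_nonneg.2 (pow_le_one₀ (by linarith) (by linarith))

lemma gammaTailApprox_le_one (m : ℕ) {x : ℝ} (hx : 0 ≤ x) : gammaTailApprox m x ≤ 1 := by
  have h1 : Real.exp (-(beta2 m * m * x)) ≤ 1 := by
    have := beta2_pos m
    exact Real.exp_le_one_iff.2 (by simpa using by positivity)
  exact sub_le_self _ (pow_nonneg (by linarith) _)

lemma gammaTail_nonneg (m : ℕ) (x : ℝ) : 0 ≤ gammaTail m x := measureReal_nonneg

lemma gammaTailApprox_eq_sum (m : ℕ) (x : ℝ) :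
    gammaTailApprox m x = ∑ k ∈ Finset.Icc 1 m, (m.choose k : ℝ) * (-1) ^ (k + 1) *
      Real.exp (-(k * beta2 m * m * x)) := by
  -- The term of index `0` in the binomial expansion is `1` and cancels the leading `1`. This is why
  -- the sum starts at `k = 1`.
  have h := add_pow (-Real.exp (-(beta2 m * m * x))) 1 m
  rw [Finset.sum_range_succ', neg_add_eq_sub] at h
  rw [gammaTailApprox, h, ← Finset.sum_image (s := Finset.range m) (g := fun k => k + 1)
    (f := fun k => (-Real.exp (-(beta2 m * m * x))) ^ k * 1 ^ (m - k) * (m.choose k : ℝ))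
    (by simp)]
  have hI : (Finset.range m).image (fun k => k + 1) = Finset.Icc 1 m := by
    ext k
    simp only [Finset.mem_image, Finset.mem_range, Finset.mem_Icc]
    exact ⟨by rintro ⟨a, ha, rfl⟩; omega, fun hk => ⟨k - 1, by omega, by omega⟩⟩
  rw [hI]
  simp only [pow_zero, one_pow, mul_one, Nat.choose_zero_right, Nat.cast_one]
  rw [sub_add_cancel_right, ← Finset.sum_neg_distrib]
  refine Finset.sum_congr rfl fun k _ => ?_
  rw [neg_pow, ← Real.exp_nat_mul, pow_succ]
  ring_nf

/-- The density of the law on `[0, ∞)` with tail `gammaTailApprox`. -/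
noncomputable def gammaTailApproxDensity (m : ℕ) (x : ℝ) : ℝ :=
  m * (1 - Real.exp (-(beta2 m * m * x))) ^ (m - 1) *
    (beta2 m * m * Real.exp (-(beta2 m * m * x)))

lemma continuous_gammaTailApproxDensity (m : ℕ) : Continuous (gammaTailApproxDensity m) := by
  unfold gammaTailApproxDensity
  fun_prop

lemma hasDerivAt_gammaTailApprox (m : ℕ) (x : ℝ) :
    HasDerivAt (fun x => -gammaTailApprox m x) (gammaTailApproxDensity m x) x := by
  unfold gammaTailApprox gammaTailApproxDensity
  have h1 := ((((hasDerivAt_id x).const_mul (beta2 m * m)).fun_neg.exp.const_sub 1).fun_pow m)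
  refine (h1.const_sub 1).fun_neg.congr_deriv ?_
  simp only [id]
  ring

lemma gammaTailApproxDensity_nonneg (m : ℕ) {x : ℝ} (hx : 0 ≤ x) :
    0 ≤ gammaTailApproxDensity m x := by
  have hb := beta2_pos m
  have h1 : Real.exp (-(beta2 m * m * x)) ≤ 1 :=
    Real.exp_le_one_iff.2 (by simpa using by positivity)
  have h2 : 0 ≤ 1 - Real.exp (-(beta2 m * m * x)) := by linarith
  unfold gammaTailApproxDensity
  positivity

/-- Since `β₂ ^ m = 1 / m!`, the usual constant `m ^ m / (m - 1)!` equals `m (β₂ m) ^ m`. This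
choice of `β₂` gives both densities the same leading behaviour at `0`, and hence a common factor to
cancel. -/
lemma gammaPDFReal_nat {m : ℕ} (hm : 1 ≤ m) {x : ℝ} (hx : 0 < x) :
    gammaPDFReal m m x = m * (beta2 m * m) ^ m * x ^ (m - 1) * Real.exp (-(m * x)) := by
  obtain ⟨n, rfl⟩ : ∃ n, m = n + 1 := ⟨m - 1, by omega⟩
  rw [gammaPDFReal, if_pos hx.le, Real.rpow_natCast, mul_pow, beta2_pow hm]
  have h1 : ((n + 1 : ℕ) : ℝ) - 1 = (n : ℕ) := by push_cast; ring
  rw [h1, Real.rpow_natCast, Nat.cast_succ, Real.Gamma_nat_eq_factorial, Nat.factorial_succ]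
  push_cast
  have : ((n : ℝ) + 1) ≠ 0 := by positivity
  field_simp

lemma gammaTailApproxDensity_eq {m : ℕ} (hm : 1 ≤ m) {x : ℝ} (hx : 0 < x) :
    gammaTailApproxDensity m x = m * (beta2 m * m) ^ m * x ^ (m - 1) *
      (Real.exp (-(beta2 m * m * x)) *
        ((1 - Real.exp (-(beta2 m * m * x))) / (beta2 m * m * x)) ^ (m - 1)) := by
  obtain ⟨n, rfl⟩ : ∃ n, m = n + 1 := ⟨m - 1, by omega⟩
  have := beta2_pos (n + 1)
  have h2 : (0 : ℝ) < (n + 1 : ℕ) := by positivity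
  rw [gammaTailApproxDensity]
  simp only [Nat.add_sub_cancel, div_pow, mul_pow, pow_succ]
  field_simp

/-- Once the density of `gammaTailApprox` exceeds that of the gain, it does so forever. -/
lemma gammaPDFReal_le_of_lt {m : ℕ} (hm : 1 ≤ m) {x y : ℝ} (hx : 0 < x) (hxy : x ≤ y)
    (h : gammaPDFReal m m x < gammaTailApproxDensity m x) :
    gammaPDFReal m m y ≤ gammaTailApproxDensity m y := by
  have hy : 0 < y := hx.trans_le hxy
  have hm0 : (0 : ℝ) < m := by positivity
  have hκ : 0 < beta2 m * m := mul_pos (beta2_pos m) hm0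
  set κ := beta2 m * m
  rw [gammaPDFReal_nat hm hx, gammaTailApproxDensity_eq hm hx] at h
  rw [gammaPDFReal_nat hm hy, gammaTailApproxDensity_eq hm hy]
  have h := lt_of_mul_lt_mul_left h (by positivity)
  refine mul_le_mul_of_nonneg_left ?_ (by positivity)
  -- After cancellation, comparing the densities at `x` amounts to comparing `exp (-(m - κ) x)` with
  -- the power `m - 1` of `(1 - exp (-κ x)) / (κ x)`.
  have ha : Real.exp (-((m - κ) * x)) ≤ ((1 - Real.exp (-(κ * x))) / (κ * x)) ^ (m - 1) := by
    have h1 : Real.exp (-(m * x)) = Real.exp (-(κ * x)) * Real.exp (-((m - κ) * x)) := by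
      rw [← Real.exp_add]
      congr 1
      ring
    rw [h1] at h
    exact (lt_of_mul_lt_mul_left h (Real.exp_nonneg _)).le
  have h1 : Real.exp (-(m * y)) = Real.exp (-(κ * y)) * Real.exp (-((m - κ) * y)) := by
    rw [← Real.exp_add]
    congr 1
    ring
  rw [h1]
  refine mul_le_mul_of_nonneg_left ?_ (Real.exp_nonneg _)
  have hpos : 0 ≤ (1 - Real.exp (-(κ * x))) / (κ * x) := by
    have : Real.exp (-(κ * x)) ≤ 1 := Real.exp_le_one_iff.2 (by simpa using by positivity)
    exact div_nonneg (by linarith) (by positivity)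
  -- Raising to the power `y / x` turns the left side at `x` exactly into the left side at `y`. By
  -- Jensen's inequality, the right side at `y` is at least that power of the right side at `x`.
  calc Real.exp (-((m - κ) * y)) = Real.exp (-((m - κ) * x)) ^ (y / x) := by
        rw [← Real.exp_mul]
        congr 1
        field_simp
    _ ≤ (((1 - Real.exp (-(κ * x))) / (κ * x)) ^ (m - 1)) ^ (y / x) :=
        Real.rpow_le_rpow (Real.exp_nonneg _) ha (by positivity)
    _ = (((1 - Real.exp (-(κ * x))) / (κ * x)) ^ (κ * y / (κ * x))) ^ (m - 1) := by
        rw [mul_div_mul_left _ _ hκ.ne', ← Real.rpow_natCast, ← Real.rpow_natCast,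
          ← Real.rpow_mul hpos, ← Real.rpow_mul hpos, mul_comm (y / x)]
    _ ≤ _ := pow_le_pow_left₀ (Real.rpow_nonneg hpos _)
        (rpow_one_sub_exp_neg_div_le (by positivity) (by gcongr)) _

lemma tendsto_gammaTailApprox {m : ℕ} (hm : 1 ≤ m) :
    Tendsto (fun x => -gammaTailApprox m x) atTop (𝓝 0) := by
  have hκ : 0 < beta2 m * m := mul_pos (beta2_pos m) (by positivity)
  have h1 : Tendsto (fun x : ℝ => Real.exp (-(beta2 m * m * x))) atTop (𝓝 0) :=
    Real.tendsto_exp_neg_atTop_nhds_zero.comp (tendsto_id.const_mul_atTop hκ)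
  have h2 := (((h1.const_sub 1).pow m).const_sub 1).neg
  simpa [gammaTailApprox] using h2

/-- An upper bound for the tail of the Gamma distribution, due to Alzer. -/
theorem gammaTail_le_gammaTailApprox {m : ℕ} (hm : 1 ≤ m) {x : ℝ} (hx : 0 ≤ x) :
    gammaTail m x ≤ gammaTailApprox m x := by
  have hm0 : (0 : ℝ) < m := by positivity
  have hprob := isProbabilityMeasure_gamma_nat hm
  -- If the approximate density has exceeded the Gamma density somewhere in `(0, x]`, it dominates
  -- on `(x, ∞)` and the tails compare directly. Otherwise it is dominated on `(0, x]`, and the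
  -- tails compare through their complements, as both laws have mass one.
  by_cases hcase : ∃ t ∈ Ioc 0 x, gammaPDFReal m m t < gammaTailApproxDensity m t
  · obtain ⟨t, ht, hlt⟩ := hcase
    have hint := integrableOn_Ioi_deriv_of_nonneg' (fun y _ => hasDerivAt_gammaTailApprox m y)
      (fun y hy => gammaTailApproxDensity_nonneg m (hx.trans (le_of_lt hy)))
      (tendsto_gammaTailApprox hm)
    have hval := integral_Ioi_of_hasDerivAt_of_tendsto'
      (fun y _ => hasDerivAt_gammaTailApprox m y) hint (tendsto_gammaTailApprox hm)
    have h1 : gammaMeasure m m (Ioi x) ≤ ENNReal.ofReal (gammaTailApprox m x) := by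
      rw [gammaMeasure, withDensity_apply _ measurableSet_Ioi]
      have h2 : ENNReal.ofReal (gammaTailApprox m x) =
          ∫⁻ y in Ioi x, ENNReal.ofReal (gammaTailApproxDensity m y) := by
        rw [← ofReal_integral_eq_lintegral_ofReal hint, hval]
        · simp
        · filter_upwards [ae_restrict_mem measurableSet_Ioi] with y hy
          exact gammaTailApproxDensity_nonneg m (hx.trans (le_of_lt hy))
      rw [h2]
      refine setLIntegral_mono' measurableSet_Ioi fun y hy => ENNReal.ofReal_le_ofReal ?_
      exact gammaPDFReal_le_of_lt hm ht.1 (ht.2.trans (le_of_lt hy)) hlt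
    exact ENNReal.toReal_le_of_le_ofReal (gammaTailApprox_nonneg m hx) h1
  · push Not at hcase
    have hval := intervalIntegral.integral_eq_sub_of_hasDerivAt
      (fun y _ => hasDerivAt_gammaTailApprox m y)
      ((continuous_gammaTailApproxDensity m).intervalIntegrable 0 x)
    rw [intervalIntegral.integral_of_le hx] at hval
    have h0 : gammaTailApprox m 0 = 1 := by simp [gammaTailApprox, Nat.one_le_iff_ne_zero.1 hm]
    rw [h0] at hval
    have h1 : ENNReal.ofReal (1 - gammaTailApprox m x) ≤ gammaMeasure m m (Iic x) := by
      calc ENNReal.ofReal (1 - gammaTailApprox m x)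
          = ∫⁻ y in Ioc 0 x, ENNReal.ofReal (gammaTailApproxDensity m y) := by
            rw [← ofReal_integral_eq_lintegral_ofReal
              (continuous_gammaTailApproxDensity m).integrableOn_Ioc, hval]
            · congr 1
              ring
            · filter_upwards [ae_restrict_mem measurableSet_Ioc] with y hy
              exact gammaTailApproxDensity_nonneg m hy.1.le
        _ ≤ ∫⁻ y in Ioc 0 x, gammaPDF m m y :=
            setLIntegral_mono' measurableSet_Ioc fun y hy => ENNReal.ofReal_le_ofReal (hcase y hy)
        _ = gammaMeasure m m (Ioc 0 x) := (withDensity_apply _ measurableSet_Ioc).symm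
        _ ≤ gammaMeasure m m (Iic x) := measure_mono Ioc_subset_Iic_self
    have h2 := (ENNReal.ofReal_le_iff_le_toReal (measure_ne_top _ _)).1 h1
    have h3 : gammaTail m x = 1 - (gammaMeasure m m).real (Iic x) := by
      rw [gammaTail, ← compl_Iic, probReal_compl_eq_one_sub measurableSet_Iic]
    rw [h3]
    change _ ≤ (gammaMeasure m m).real (Iic x) at h2
    linarith

/-- A real supremum of an unbounded family is `0` by convention. Boundedness makes `gammaTailError`
a genuine upper bound for the error. -/
lemma bddAbove_gammaTailError {m : ℕ} (hm : 1 ≤ m) :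
    BddAbove (range fun x : ℝ≥0 => |gammaTailApprox m x - gammaTail m x|) := by
  refine ⟨1, ?_⟩
  rintro _ ⟨x, rfl⟩
  have h1 := gammaTail_le_gammaTailApprox hm x.coe_nonneg
  have h2 := gammaTailApprox_le_one m x.coe_nonneg
  have h3 := gammaTail_nonneg m x
  exact abs_le.2 ⟨by linarith, by linarith⟩

lemma gammaTailApprox_sub_le {m : ℕ} (hm : 1 ≤ m) {x : ℝ} (hx : 0 ≤ x) :
    gammaTailApprox m x - gammaTail m x ≤ gammaTailError m :=
  (le_abs_self _).trans (le_ciSup (bddAbove_gammaTailError hm) (⟨x, hx⟩ : ℝ≥0))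

lemma gammaTailError_nonneg (m : ℕ) : 0 ≤ gammaTailError m :=
  Real.iSup_nonneg fun _ => abs_nonneg _

/-! ### Polar coordinates -/

/-- Integration of a radial function over the plane, in terms of the distance to a point at
altitude `h` above the origin. -/
lemma integral_plane_radial {h : ℝ} (hh : 0 < h) (φ : ℝ → ℝ) :
    ∫ v : Plane, φ ‖v‖ = 2 * Real.pi * ∫ z in Ioi h, z * φ (Real.sqrt (z ^ 2 - h ^ 2)) := by
  have hball : (volume : Measure Plane).real (Metric.ball 0 1) = Real.pi := by
    simp [measureReal_def, EuclideanSpace.volume_ball_fin_two, Real.pi_nonneg]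
  have hpos (z : ℝ) (hz : z ∈ Ioi h) : 0 < z ^ 2 - h ^ 2 := by
    have : h < z := hz
    nlinarith
  have himage : (fun z => Real.sqrt (z ^ 2 - h ^ 2)) '' Ioi h = Ioi 0 := by
    ext t
    constructor
    · rintro ⟨z, hz, rfl⟩
      exact Real.sqrt_pos.2 (hpos z hz)
    · intro (ht : 0 < t)
      refine ⟨Real.sqrt (t ^ 2 + h ^ 2), Real.lt_sqrt_of_sq_lt (by nlinarith), ?_⟩
      simp only
      rw [Real.sq_sqrt (by positivity), add_sub_cancel_right, Real.sqrt_sq ht.le]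
  have hderiv (z : ℝ) (hz : z ∈ Ioi h) : HasDerivWithinAt (fun z => Real.sqrt (z ^ 2 - h ^ 2))
      (z / Real.sqrt (z ^ 2 - h ^ 2)) (Ioi h) z := by
    have h1 := (((hasDerivAt_id z).fun_pow 2).sub_const (h ^ 2)).sqrt (hpos z hz).ne'
    refine (h1.congr_deriv ?_).hasDerivWithinAt
    simp only [id]
    push_cast
    field_simp
  have hinj : InjOn (fun z => Real.sqrt (z ^ 2 - h ^ 2)) (Ioi h) := by
    intro a ha b hb hab
    have h1 := (Real.sqrt_inj (hpos a ha).le (hpos b hb).le).1 hab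
    have ha' : h < a := ha
    have hb' : h < b := hb
    exact (pow_left_inj₀ (by linarith) (by linarith) two_ne_zero).1 (sub_left_injective h1)
  -- The factor `2π` is the dimension times the area of the unit disc. The substitution `t = √(z² -
  -- h²)` turns `t dt` into `z dz`.
  rw [integral_fun_norm_addHaar volume φ, hball, finrank_euclideanSpace_fin, ← himage,
    integral_image_eq_integral_abs_deriv_smul measurableSet_Ioi hderiv hinj]
  simp only [nsmul_eq_mul, smul_eq_mul, Nat.cast_ofNat, Nat.add_one_sub_one, pow_one]
  rw [← mul_assoc]
  congr 1
  refine setIntegral_congr_fun measurableSet_Ioi fun z hz => ?_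
  have h1 := Real.sqrt_pos.2 (hpos z hz)
  have h2 : 0 < z := hh.trans hz
  rw [abs_of_pos (div_pos h2 h1)]
  field_simp

/-- The distance between a user and its cluster UAV has density `distDensity`. -/
lemma integral_disc_radial {p : Params} (hp : p.Admissible) (φ : ℝ → ℝ) :
    ∫ v, φ ‖v‖ ∂(cond volume (Metric.closedBall (0 : Plane) p.rc)) =
      ∫ r in p.h..Real.sqrt (p.rc ^ 2 + p.h ^ 2),
        φ (Real.sqrt (r ^ 2 - p.h ^ 2)) * distDensity p r := by
  have hh := hp.h_pos
  have hrc := hp.rc_pos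
  have hle : p.h ≤ Real.sqrt (p.rc ^ 2 + p.h ^ 2) := Real.le_sqrt_of_sq_le (by nlinarith)
  have hvol : volume (Metric.closedBall (0 : Plane) p.rc) =
      ENNReal.ofReal (Real.pi * p.rc ^ 2) := by
    rw [EuclideanSpace.volume_closedBall_fin_two, ← ENNReal.ofReal_pow hrc.le, mul_comm,
      ENNReal.ofReal_mul Real.pi_nonneg]
  have hind : ∫ v in Metric.closedBall (0 : Plane) p.rc, φ ‖v‖ =
      ∫ v : Plane, (Iic p.rc).indicator φ ‖v‖ := by
    rw [← integral_indicator measurableSet_closedBall]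
    congr 1 with v
    simp [indicator]
  rw [ProbabilityTheory.cond, integral_smul_measure, hind, integral_plane_radial hh, hvol,
    smul_eq_mul, ENNReal.toReal_inv, ENNReal.toReal_ofReal (by positivity),
    intervalIntegral.integral_of_le hle]
  -- The disc `t ≤ rc` becomes `z ≤ √(rc² + h²)`. Dividing `2π z` by the area `π rc²` then gives the
  -- density.
  have hset : ∫ z in Ioi p.h, z * (Iic p.rc).indicator φ (Real.sqrt (z ^ 2 - p.h ^ 2)) =
      ∫ z in Ioc p.h (Real.sqrt (p.rc ^ 2 + p.h ^ 2)), z * φ (Real.sqrt (z ^ 2 - p.h ^ 2)) := by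
    have hIoc : Ioc p.h (Real.sqrt (p.rc ^ 2 + p.h ^ 2)) =
        Ioi p.h ∩ Iic (Real.sqrt (p.rc ^ 2 + p.h ^ 2)) := rfl
    rw [hIoc, ← setIntegral_indicator measurableSet_Iic]
    refine setIntegral_congr_fun measurableSet_Ioi fun z hz => ?_
    have hz' : 0 < z := hh.trans hz
    have : Real.sqrt (z ^ 2 - p.h ^ 2) ≤ p.rc ↔ z ≤ Real.sqrt (p.rc ^ 2 + p.h ^ 2) := by
      rw [Real.sqrt_le_left hrc.le, Real.le_sqrt' hz', sub_le_iff_le_add]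
    by_cases hc : z ≤ Real.sqrt (p.rc ^ 2 + p.h ^ 2)
    · simp [indicator, hc, this.2 hc]
    · simp [indicator, hc, mt this.1 hc]
  rw [hset, ← mul_assoc, ← integral_const_mul]
  refine setIntegral_congr_fun measurableSet_Ioc fun z hz => ?_
  rw [distDensity, if_pos ⟨hz.1.le, hz.2⟩]
  have := Real.pi_pos
  field_simp

/-! ### Averaging over the fading -/

lemma dist3_pos {p : Params} (hp : p.Admissible) (v : Plane) : 0 < dist3 p v := by
  have := hp.h_pos
  exact Real.sqrt_pos.2 (by positivity)

/-- Ratio of the received power of the `i`-th interfering user and its gain. -/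
noncomputable def interferenceCoeff (p : Params) (x : Realization) (i : ℕ) : ℝ :=
  transmitPower p (x.ownState p (some i)) (x.R p (some i)) * p.eta (x.refState p i) *
    x.D p i ^ (-p.alpha (x.refState p i))

lemma interferenceCoeff_nonneg {p : Params} (hp : p.Admissible) (x : Realization) (i : ℕ) :
    0 ≤ interferenceCoeff p x i := by
  have h1 := (hp.rho_pos (x.ownState p (some i))).le
  have h2 := (hp.eta_pos (x.refState p i)).le
  have h3 : 0 < x.R p (some i) := dist3_pos hp _
  have h4 : 0 < x.D p i := dist3_pos hp _
  unfold interferenceCoeff transmitPower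
  positivity

lemma interference_eq (p : Params) (x : Realization) (G : Gains) :
    interference p x G =
      ∑' i, ENNReal.ofReal (interferenceCoeff p x i * G (some i, x.refState p i)) := by
  unfold interference receivedPower interferenceCoeff
  exact tsum_congr fun i => by ring_nf

lemma gCoeff_nonneg {p : Params} (hp : p.Admissible) (s : LinkState) {θ : ℝ} (hθ : 0 < θ) (k : ℕ)
    {r : ℝ} (hr : 0 < r) : 0 ≤ gCoeff p s θ k r := by
  have h1 := hp.rho_pos s
  have h2 := hp.eta_pos s
  have h3 := beta2_pos (p.m s)
  unfold gCoeff
  positivity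

/-- In this form the factor is the Laplace transform of a Gamma gain, evaluated at `g` times the
received power per unit gain. -/
lemma fFactor_eq (p : Params) (x : Realization) (i : ℕ) (g : ℝ) :
    fFactor p (x.ownState p (some i)) (x.refState p i) g (x.R p (some i)) (x.D p i) =
      ((p.m (x.refState p i) : ℝ) /
        (p.m (x.refState p i) + g * interferenceCoeff p x i)) ^ p.m (x.refState p i) := by
  unfold fFactor interferenceCoeff transmitPower
  ring_nf

lemma fFactor_nonneg {p : Params} (hp : p.Admissible) (e j : LinkState) {g R D : ℝ} (hg : 0 ≤ g)
    (hR : 0 < R) (hD : 0 < D) : 0 ≤ fFactor p e j g R D := by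
  have h1 := hp.rho_pos e
  have h2 := hp.eta_pos j
  unfold fFactor
  positivity

lemma fFactor_le_one {p : Params} (hp : p.Admissible) (e j : LinkState) {g R D : ℝ} (hg : 0 ≤ g)
    (hR : 0 < R) (hD : 0 < D) : fFactor p e j g R D ≤ 1 := by
  have h1 := hp.rho_pos e
  have h2 := hp.eta_pos j
  have h3 : 0 ≤ g * p.rho e * p.eta j * R ^ (p.alpha e * p.eps e) * D ^ (-p.alpha j) := by
    positivity
  exact pow_le_one₀ (by positivity) (div_le_one_of_le₀ (by linarith) (by positivity))

lemma measurable_interference (p : Params) (x : Realization) : Measurable (interference p x) := by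
  rw [funext (interference_eq p x)]
  exact Measurable.tsum fun i => ((measurable_pi_apply _).const_mul _).ennreal_ofReal

section gainLaw

variable {p : Params} (hp : p.Admissible)
include hp

lemma isProbabilityMeasure_gainLaw : IsProbabilityMeasure (gainLaw p) := by
  have (k : Option ℕ × LinkState) : IsProbabilityMeasure (gammaMeasure (p.m k.2) (p.m k.2)) :=
    isProbabilityMeasure_gamma_nat (hp.m_pos _)
  unfold gainLaw
  infer_instance

lemma measurePreserving_eval_gainLaw (k : Option ℕ × LinkState) :
    MeasurePreserving (fun G : Gains => G k) (gainLaw p) (gammaMeasure (p.m k.2) (p.m k.2)) := by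
  have (k : Option ℕ × LinkState) : IsProbabilityMeasure (gammaMeasure (p.m k.2) (p.m k.2)) :=
    isProbabilityMeasure_gamma_nat (hp.m_pos _)
  exact measurePreserving_eval_infinitePi _ k

lemma iIndepFun_gainLaw : iIndepFun (fun k (G : Gains) => G k) (gainLaw p) := by
  have (k : Option ℕ × LinkState) : IsProbabilityMeasure (gammaMeasure (p.m k.2) (p.m k.2)) :=
    isProbabilityMeasure_gamma_nat (hp.m_pos _)
  exact iIndepFun_infinitePi (X := fun _ g => g) fun _ => measurable_id

/-- The Laplace transform of the interference given the locations and link states. -/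
lemma lintegral_expNeg_interference (x : Realization) {g : ℝ} (hg : 0 ≤ g) :
    (∫⁻ G, expNeg (ENNReal.ofReal g * interference p x G) ∂(gainLaw p)).toReal =
      ∏' i, fFactor p (x.ownState p (some i)) (x.refState p i) g (x.R p (some i)) (x.D p i) := by
  have := isProbabilityMeasure_gainLaw hp
  have hR (i : ℕ) : 0 < x.R p (some i) := dist3_pos hp _
  have hD (i : ℕ) : 0 < x.D p i := dist3_pos hp _
  have hc (i : ℕ) : 0 ≤ g * interferenceCoeff p x i :=
    mul_nonneg hg (interferenceCoeff_nonneg hp x i)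
  have hsum (G : Gains) : ENNReal.ofReal g * interference p x G =
      ∑' i, ENNReal.ofReal (g * interferenceCoeff p x i * G (some i, x.refState p i)) := by
    rw [interference_eq, ← ENNReal.tsum_mul_left]
    exact tsum_congr fun i => by rw [← ENNReal.ofReal_mul hg, mul_assoc]
  -- Each interferer uses only the gain of its actual link state. Distinct interferers use distinct
  -- indices, so these gains are independent.
  have hind := (iIndepFun_gainLaw hp).precomp (g := fun i : ℕ => (some i, x.refState p i))
    (fun i j hij => by simpa using congrArg Prod.fst hij)
  have hm (i : ℕ) : Measurable fun t => ENNReal.ofReal (g * interferenceCoeff p x i * t) := by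
    fun_prop
  simp_rw [hsum]
  rw [lintegral_expNeg_tsum (Z := fun i (G : Gains) => G (some i, x.refState p i))
    (fun i => measurable_pi_apply _) hind hm,
    tprod_eq_expNeg_tsum _ (fun i => fFactor_nonneg hp _ _ hg (hR i) (hD i))
      (fun i => fFactor_le_one hp _ _ hg (hR i) (hD i))]
  congr 2
  refine tsum_congr fun i => ?_
  have h1 := (measurePreserving_eval_gainLaw hp (some i, x.refState p i)).lintegral_comp
    (measurable_expNeg.comp (hm i))
  simp only [Function.comp_def] at h1
  rw [h1, lintegral_expNeg_gammaMeasure (hp.m_pos _) (hc i), fFactor_eq]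

/-- The gain of the reference link is independent of the interference. -/
lemma indepFun_gain_interference (x : Realization) (s : LinkState) :
    IndepFun (fun G : Gains => G (none, s)) (interference p x) (gainLaw p) := by
  have := isProbabilityMeasure_gainLaw hp
  -- The interference reads only gains with first index `some i`, which lie outside `S`.
  let S : Set (Option ℕ × LinkState) := {k | k.1 = none}
  have h : IndepFun (fun (G : Gains) (k : S) => G k) (fun G (k : (Sᶜ : Set _)) => G k)
      (gainLaw p) :=
    indepFun_of_disjoint_of_iIndepFun (fun k => measurable_pi_apply k)
      (iIndepFun_gainLaw hp) disjoint_compl_right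
  have hm1 : Measurable fun w : S → ℝ => w ⟨(none, s), rfl⟩ := measurable_pi_apply _
  have hm2 : Measurable fun w : (Sᶜ : Set _) → ℝ => ∑' i, ENNReal.ofReal
      (interferenceCoeff p x i * w ⟨(some i, x.refState p i), by simp [S]⟩) :=
    Measurable.tsum fun i => ((measurable_pi_apply _).const_mul _).ennreal_ofReal
  have h1 := h.comp hm1 hm2
  rw [funext (interference_eq p x)]
  exact h1

end gainLaw

/-- Success probability given the interference `t`, over a reference link of length `r` in
state `s`. -/
noncomputable def successGiven (p : Params) (s : LinkState) (θ r : ℝ) (t : ℝ≥0∞) : ℝ :=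
  (gammaMeasure (p.m s) (p.m s)).real {g | ENNReal.ofReal θ <
    ENNReal.ofReal (receivedPower p (transmitPower p s r) s g r) / (t + ENNReal.ofReal p.noise)}

/-- The approximation of `successGiven`. -/
noncomputable def approxGiven (p : Params) (s : LinkState) (θ r : ℝ) (t : ℝ≥0∞) : ℝ :=
  ∑ k ∈ Finset.Icc 1 (p.m s), ((p.m s).choose k : ℝ) * (-1) ^ (k + 1) *
    Real.exp (-(gCoeff p s θ k r * p.noise)) *
      (expNeg (ENNReal.ofReal (gCoeff p s θ k r) * t)).toReal

lemma successGiven_top (p : Params) (s : LinkState) (θ r : ℝ) : successGiven p s θ r ∞ = 0 := by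
  simp [successGiven]

section Given

variable {p : Params} (hp : p.Admissible) (s : LinkState) {θ r : ℝ} (hθ : 0 < θ) (hr : 0 < r)
include hp hθ hr

lemma gCoeff_pos {k : ℕ} (hk : 1 ≤ k) : 0 < gCoeff p s θ k r := by
  have h1 := hp.rho_pos s
  have h2 := hp.eta_pos s
  have h3 := beta2_pos (p.m s)
  have h4 := hp.m_pos s
  unfold gCoeff
  positivity

/-- As `k ≥ 1`, every coefficient is positive and every exponential vanishes at infinite
interference. This agrees with `successGiven_top`, so the comparison needs no finiteness of the
interference. -/
lemma approxGiven_top : approxGiven p s θ r ∞ = 0 := by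
  refine Finset.sum_eq_zero fun k hk => ?_
  have := gCoeff_pos hp s hθ hr (Finset.mem_Icc.1 hk).1
  rw [ENNReal.mul_top (by simpa using this)]
  simp

/-- Solving `SINR > θ` for the gain: power control and path loss combine to `r ^ (-(1 - ε) α)`. -/
lemma successGiven_ofReal {t : ℝ} (ht : 0 ≤ t) : successGiven p s θ r (ENNReal.ofReal t) =
    gammaTail (p.m s) (θ * r ^ ((1 - p.eps s) * p.alpha s) * (p.rho s * p.eta s)⁻¹ *
      (t + p.noise)) := by
  have h1 := hp.rho_pos s
  have h2 := hp.eta_pos s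
  have hn := hp.noise_pos
  have hts : 0 < t + p.noise := by linarith
  unfold successGiven gammaTail
  congr 1
  ext g
  have hpow : r ^ (p.alpha s * p.eps s) * r ^ (-p.alpha s) *
      r ^ ((1 - p.eps s) * p.alpha s) = 1 := by
    rw [← Real.rpow_add hr, ← Real.rpow_add hr]
    ring_nf
    simp
  have hq : 0 < r ^ ((1 - p.eps s) * p.alpha s) := Real.rpow_pos_of_pos hr _
  have hrec : receivedPower p (transmitPower p s r) s g r =
      (p.rho s * p.eta s) * g / r ^ ((1 - p.eps s) * p.alpha s) := by
    rw [eq_div_iff hq.ne', receivedPower, transmitPower]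
    linear_combination p.rho s * p.eta s * g * hpow
  rw [mem_ofPred_eq, mem_Ioi, ← ENNReal.ofReal_add ht hn.le,
    ENNReal.lt_div_iff_mul_lt (Or.inl (by simpa using hts)) (Or.inl ENNReal.ofReal_ne_top),
    ← ENNReal.ofReal_mul hθ.le, ENNReal.ofReal_lt_ofReal_iff_of_nonneg (by positivity), hrec,
    lt_div_iff₀ hq, ← div_eq_mul_inv, div_mul_eq_mul_div, div_lt_iff₀ (by positivity)]
  ring_nf

/-- Each binomial term is exponential in the threshold, so it splits into a noise factor and an
interference factor. -/
lemma approxGiven_ofReal {t : ℝ} (ht : 0 ≤ t) : approxGiven p s θ r (ENNReal.ofReal t) =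
    gammaTailApprox (p.m s) (θ * r ^ ((1 - p.eps s) * p.alpha s) * (p.rho s * p.eta s)⁻¹ *
      (t + p.noise)) := by
  rw [gammaTailApprox_eq_sum, approxGiven]
  refine Finset.sum_congr rfl fun k _ => ?_
  have hg := gCoeff_nonneg hp s hθ k hr
  rw [← ENNReal.ofReal_mul hg, expNeg_ofReal (by positivity),
    ENNReal.toReal_ofReal (Real.exp_nonneg _), mul_assoc, ← Real.exp_add]
  congr 2
  unfold gCoeff
  ring

lemma successGiven_le_approxGiven (t : ℝ≥0∞) :
    successGiven p s θ r t ≤ approxGiven p s θ r t := by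
  have h1 := hp.rho_pos s
  have h2 := hp.eta_pos s
  have hn := hp.noise_pos
  induction t using ENNReal.recTopCoe with
  | top => rw [successGiven_top, approxGiven_top hp s hθ hr]
  | coe t =>
    rw [← ENNReal.ofReal_coe_nnreal, successGiven_ofReal hp s hθ hr t.coe_nonneg,
      approxGiven_ofReal hp s hθ hr t.coe_nonneg]
    exact gammaTail_le_gammaTailApprox (hp.m_pos s) (by positivity)

lemma approxGiven_le_add (t : ℝ≥0∞) :
    approxGiven p s θ r t ≤ successGiven p s θ r t + gammaTailError (p.m s) := by
  have h1 := hp.rho_pos s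
  have h2 := hp.eta_pos s
  have hn := hp.noise_pos
  induction t using ENNReal.recTopCoe with
  | top =>
    rw [successGiven_top, approxGiven_top hp s hθ hr, zero_add]
    exact gammaTailError_nonneg _
  | coe t =>
    rw [← ENNReal.ofReal_coe_nnreal, successGiven_ofReal hp s hθ hr t.coe_nonneg,
      approxGiven_ofReal hp s hθ hr t.coe_nonneg, ← sub_le_iff_le_add']
    exact gammaTailApprox_sub_le (hp.m_pos s) (by positivity)

lemma approxGiven_le_one (t : ℝ≥0∞) : approxGiven p s θ r t ≤ 1 := by
  have h1 := hp.rho_pos s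
  have h2 := hp.eta_pos s
  have hn := hp.noise_pos
  induction t using ENNReal.recTopCoe with
  | top =>
    rw [approxGiven_top hp s hθ hr]
    exact zero_le_one
  | coe t =>
    rw [← ENNReal.ofReal_coe_nnreal, approxGiven_ofReal hp s hθ hr t.coe_nonneg]
    exact gammaTailApprox_le_one _ (by positivity)

end Given

lemma measurable_approxGiven (p : Params) (s : LinkState) (θ r : ℝ) :
    Measurable (approxGiven p s θ r) := by
  unfold approxGiven
  refine Finset.measurable_sum _ fun k _ => Measurable.const_mul ?_ _
  exact (measurable_expNeg.comp (measurable_const.mul measurable_id)).ennreal_toReal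

lemma measurableSet_success (p : Params) (s : LinkState) (θ r : ℝ) :
    MeasurableSet {z : ℝ × ℝ≥0∞ | ENNReal.ofReal θ <
      ENNReal.ofReal (receivedPower p (transmitPower p s r) s z.1 r) /
        (z.2 + ENNReal.ofReal p.noise)} := by
  refine measurableSet_lt measurable_const (Measurable.div ?_ (by fun_prop))
  unfold receivedPower
  fun_prop

section Fading

variable {p : Params} (hp : p.Admissible) {θ : ℝ} (x : Realization)
include hp

lemma measurable_successGiven (s : LinkState) (r : ℝ) : Measurable (successGiven p s θ r) := by
  have := isProbabilityMeasure_gamma_nat (hp.m_pos s)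
  exact (measurable_measure_prodMk_right (measurableSet_success p s θ r)).ennreal_toReal

/-- By independence, the joint law of reference gain and interference is a product, and Tonelli
allows the gain to be integrated first. -/
lemma condSuccess_eq_integral : condSuccess p θ x =
    ∫ G, successGiven p (x.ownState p none) θ (x.R p none) (interference p x G) ∂(gainLaw p) := by
  set s := x.ownState p none with hs
  set r := x.R p none
  have hprob := isProbabilityMeasure_gamma_nat (hp.m_pos s)
  have := isProbabilityMeasure_gainLaw hp
  have hI := measurable_interference p x
  have hA := measurePreserving_eval_gainLaw hp (none, s)
  have hmap := (indepFun_iff_map_prod_eq_prod_map_map hA.measurable.aemeasurable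
    hI.aemeasurable).1 (indepFun_gain_interference hp x s)
  have hset := measurableSet_success p s θ r
  have h1 : gainLaw p {G | ENNReal.ofReal θ < sinr p x G} =
      ∫⁻ G, gammaMeasure (p.m s) (p.m s) {g | ENNReal.ofReal θ <
        ENNReal.ofReal (receivedPower p (transmitPower p s r) s g r) /
          (interference p x G + ENNReal.ofReal p.noise)} ∂(gainLaw p) := by
    have h2 := congrArg (fun ν => ν {z : ℝ × ℝ≥0∞ | ENNReal.ofReal θ <
      ENNReal.ofReal (receivedPower p (transmitPower p s r) s z.1 r) /
        (z.2 + ENNReal.ofReal p.noise)}) hmap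
    rw [Measure.map_apply (hA.measurable.prodMk hI) hset, hA.map_eq,
      Measure.prod_apply_symm hset, lintegral_map (measurable_measure_prodMk_right hset) hI] at h2
    exact h2
  rw [condSuccess, measureReal_def, h1]
  refine (integral_toReal ?_ (ae_of_all _ fun G => measure_lt_top _ _)).symm
  exact ((measurable_measure_prodMk_right hset).comp hI).aemeasurable

/-- Puts the approximation over the same fading average as the exact probability, so that a
pointwise inequality between tails can be integrated. -/
lemma approxSuccessOn_eq_integral (hθ : 0 < θ) (s : LinkState) (hs : x.ownState p none = s) :
    approxSuccessOn p s θ x =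
      ∫ G, approxGiven p s θ (x.R p none) (interference p x G) ∂(gainLaw p) := by
  have := isProbabilityMeasure_gainLaw hp
  have hr : 0 < x.R p none := dist3_pos hp _
  have hm (k : ℕ) : Measurable fun G =>
      expNeg (ENNReal.ofReal (gCoeff p s θ k (x.R p none)) * interference p x G) :=
    measurable_expNeg.comp (measurable_const.mul (measurable_interference p x))
  rw [approxSuccessOn, if_pos hs]
  unfold approxGiven
  rw [integral_finsetSum]
  · refine Finset.sum_congr rfl fun k _ => ?_
    rw [integral_const_mul, integral_toReal (hm k).aemeasurable
      (ae_of_all _ fun G => (expNeg_ne_top _).lt_top),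
      lintegral_expNeg_interference hp x (gCoeff_nonneg hp s hθ k hr)]
  · intro k _
    refine Integrable.const_mul (Integrable.of_bound (hm k).ennreal_toReal.aestronglyMeasurable 1
      (ae_of_all _ fun G => ?_)) _
    rw [Real.norm_of_nonneg ENNReal.toReal_nonneg]
    exact ENNReal.toReal_le_of_le_ofReal zero_le_one (by simpa using expNeg_le_one _)

/-- Comparison of the conditional success probability with its approximation. -/
lemma condSuccessOn_le_approxSuccessOn (hθ : 0 < θ) (s : LinkState) :
    condSuccessOn p s θ x ≤ approxSuccessOn p s θ x ∧
      approxSuccessOn p s θ x ≤ condSuccessOn p s θ x + gammaTailError (p.m s) ∧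
      approxSuccessOn p s θ x ≤ 1 := by
  have := isProbabilityMeasure_gainLaw hp
  by_cases hs : x.ownState p none = s
  · have hr : 0 < x.R p none := dist3_pos hp _
    have hI := measurable_interference p x
    have h0 (G : Gains) : 0 ≤ successGiven p s θ (x.R p none) (interference p x G) :=
      measureReal_nonneg
    have hle (G : Gains) := successGiven_le_approxGiven hp s hθ hr (interference p x G)
    have hone (G : Gains) := approxGiven_le_one hp s hθ hr (interference p x G)
    have hi : Integrable (fun G => successGiven p s θ (x.R p none) (interference p x G))
        (gainLaw p) :=
      Integrable.of_bound ((measurable_successGiven hp s _).comp hI).aestronglyMeasurable 1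
        (ae_of_all _ fun G => by
          rw [Real.norm_of_nonneg (h0 G)]
          exact (hle G).trans (hone G))
    have hi' : Integrable (fun G => approxGiven p s θ (x.R p none) (interference p x G))
        (gainLaw p) :=
      Integrable.of_bound ((measurable_approxGiven p s _ _).comp hI).aestronglyMeasurable 1
        (ae_of_all _ fun G => by
          rw [Real.norm_of_nonneg ((h0 G).trans (hle G))]
          exact hone G)
    rw [condSuccessOn, if_pos hs, condSuccess_eq_integral hp x,
      approxSuccessOn_eq_integral hp x hθ s hs, hs]
    refine ⟨integral_mono hi hi' hle, ?_, ?_⟩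
    · calc _ ≤ ∫ G, (successGiven p s θ (x.R p none) (interference p x G) +
            gammaTailError (p.m s)) ∂(gainLaw p) :=
          integral_mono hi' (hi.add (integrable_const _))
            fun G => approxGiven_le_add hp s hθ hr (interference p x G)
        _ = _ := by rw [integral_add hi (integrable_const _)]; simp
    · calc _ ≤ ∫ _, (1 : ℝ) ∂(gainLaw p) := integral_mono hi' (integrable_const _) hone
        _ = 1 := by simp
  · simp [condSuccessOn, approxSuccessOn, hs, gammaTailError_nonneg]

end Fading

/-! ### Measurability -/

lemma measurable_losProb (p : Params) : Measurable (losProb p) := by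
  unfold losProb
  fun_prop

lemma measurable_linkProb (p : Params) (s : LinkState) : Measurable (linkProb p s) := by
  cases s
  · exact measurable_losProb p
  · exact (measurable_losProb p).const_sub 1

@[fun_prop]
lemma measurable_dist3 (p : Params) : Measurable (dist3 p) := by
  unfold dist3
  fun_prop

/-- Expressions in a link state are measurable if they are so for each state. -/
lemma measurable_linkState {α β : Type*} [MeasurableSpace α] [MeasurableSpace β] (p : Params)
    {v : α → Plane} {u : α → ℝ} {f : LinkState → α → β} (hv : Measurable v) (hu : Measurable u)
    (hf : ∀ s, Measurable (f s)) : Measurable fun a => f (linkState p (v a) (u a)) a := by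
  have h : (fun a => f (linkState p (v a) (u a)) a) =
      fun a => if u a ≤ losProb p ‖v a‖ then f .los a else f .nlos a := by
    ext a
    unfold linkState
    split_ifs <;> rfl
  rw [h]
  exact Measurable.ite (measurableSet_le hu ((measurable_losProb p).comp hv.norm)) (hf _) (hf _)

lemma measurable_fFactor (p : Params) (e j : LinkState) :
    Measurable fun z : ℝ × ℝ × ℝ => fFactor p e j z.1 z.2.1 z.2.2 := by
  unfold fFactor
  fun_prop

lemma measurable_gCoeff (p : Params) (s : LinkState) (θ : ℝ) (k : ℕ) :
    Measurable (gCoeff p s θ k) := by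
  unfold gCoeff
  fun_prop

/-- The index of the gain in use depends on the random link state. Fixing the states one at a time
with `measurable_linkState` leaves only coordinate projections. -/
lemma measurable_sinr (p : Params) :
    Measurable fun z : ((ℕ → Plane) × (Option ℕ → Mark)) × Gains => sinr p ⟨z.1.1, z.1.2⟩ z.2 := by
  unfold sinr interference Realization.ownState Realization.refState
  refine Measurable.div ?_ (Measurable.add (Measurable.tsum fun i => ?_) measurable_const)
  · refine measurable_linkState p (f := fun s (z : ((ℕ → Plane) × (Option ℕ → Mark)) × Gains) =>
      ENNReal.ofReal (receivedPower p (transmitPower p s (Realization.R p ⟨z.1.1, z.1.2⟩ none))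
        s (z.2 (none, s)) (Realization.R p ⟨z.1.1, z.1.2⟩ none))) (by fun_prop) (by fun_prop)
      fun s => ?_
    unfold receivedPower transmitPower Realization.R
    fun_prop
  · refine measurable_linkState p (f := fun e (z : ((ℕ → Plane) × (Option ℕ → Mark)) × Gains) =>
      ENNReal.ofReal (receivedPower p
        (transmitPower p e (Realization.R p ⟨z.1.1, z.1.2⟩ (some i)))
        (linkState p (z.1.1 i + (z.1.2 (some i)).1) (z.1.2 (some i)).2.2)
        (z.2 (some i, linkState p (z.1.1 i + (z.1.2 (some i)).1) (z.1.2 (some i)).2.2))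
        (Realization.D p ⟨z.1.1, z.1.2⟩ i))) (by fun_prop) (by fun_prop) fun e => ?_
    refine measurable_linkState p (f := fun j (z : ((ℕ → Plane) × (Option ℕ → Mark)) × Gains) =>
      ENNReal.ofReal (receivedPower p
        (transmitPower p e (Realization.R p ⟨z.1.1, z.1.2⟩ (some i))) j
        (z.2 (some i, j)) (Realization.D p ⟨z.1.1, z.1.2⟩ i))) (by fun_prop) (by fun_prop)
      fun j => ?_
    unfold receivedPower transmitPower Realization.R Realization.D
    fun_prop

lemma measurable_condSuccess {p : Params} (hp : p.Admissible) (θ : ℝ) :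
    Measurable fun z : (ℕ → Plane) × (Option ℕ → Mark) => condSuccess p θ ⟨z.1, z.2⟩ := by
  have := isProbabilityMeasure_gainLaw hp
  exact (measurable_measure_prodMk_left
    (measurableSet_lt measurable_const (measurable_sinr p))).ennreal_toReal

lemma measurable_condSuccessOn {p : Params} (hp : p.Admissible) (θ : ℝ) (s : LinkState) :
    Measurable fun z : (ℕ → Plane) × (Option ℕ → Mark) => condSuccessOn p s θ ⟨z.1, z.2⟩ := by
  unfold condSuccessOn Realization.ownState
  refine measurable_linkState p (f := fun e (z : (ℕ → Plane) × (Option ℕ → Mark)) =>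
      if e = s then condSuccess p θ ⟨z.1, z.2⟩ else 0) (by fun_prop) (by fun_prop) fun e => ?_
  split_ifs
  · exact measurable_condSuccess hp θ
  · exact measurable_const

/-- The exponent of the product over `l` of the factors `fFactor` with coefficients `g l`, for a
cluster with centre `c` and mark `y`. -/
noncomputable def factorExponent (p : Params) {b : ℕ} (g : Fin b → ℝ) (c : Plane) (y : Mark) :
    ℝ≥0∞ :=
  ∑ l, negLog (ENNReal.ofReal (fFactor p (linkState p y.1 y.2.1) (linkState p (c + y.1) y.2.2)
    (g l) (dist3 p y.1) (dist3 p (c + y.1))))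

lemma measurable_factorExponent (p : Params) (b : ℕ) :
    Measurable fun z : (Fin b → ℝ) × Plane × Mark => factorExponent p z.1 z.2.1 z.2.2 := by
  unfold factorExponent
  refine Finset.measurable_sum _ fun l _ => ?_
  refine measurable_linkState p (f := fun e (z : (Fin b → ℝ) × Plane × Mark) =>
    negLog (ENNReal.ofReal (fFactor p e (linkState p (z.2.1 + z.2.2.1) z.2.2.2.2)
    (z.1 l) (dist3 p z.2.2.1) (dist3 p (z.2.1 + z.2.2.1))))) (by fun_prop) (by fun_prop) fun e => ?_
  refine measurable_linkState p (f := fun j (z : (Fin b → ℝ) × Plane × Mark) =>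
    negLog (ENNReal.ofReal (fFactor p e j
    (z.1 l) (dist3 p z.2.2.1) (dist3 p (z.2.1 + z.2.2.1))))) (by fun_prop) (by fun_prop) fun j => ?_
  refine measurable_negLog.comp (Measurable.ennreal_ofReal ?_)
  exact (measurable_fFactor p e j).comp
    (f := fun z : (Fin b → ℝ) × Plane × Mark =>
      (z.1 l, dist3 p z.2.2.1, dist3 p (z.2.1 + z.2.2.1))) (by fun_prop)

lemma measurable_factorExponent_comp {α : Type*} [MeasurableSpace α] (p : Params) {b : ℕ}
    {g : α → Fin b → ℝ} {c : α → Plane} {y : α → Mark} (hg : Measurable g) (hc : Measurable c)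
    (hy : Measurable y) : Measurable fun a => factorExponent p (g a) (c a) (y a) :=
  (measurable_factorExponent p b).comp (f := fun a => (g a, c a, y a)) (hg.prodMk (hc.prodMk hy))

lemma expNeg_factorExponent {p : Params} (hp : p.Admissible) {b : ℕ} {g : Fin b → ℝ}
    (hg : ∀ l, 0 ≤ g l) (c : Plane) (y : Mark) :
    expNeg (factorExponent p g c y) =
      ENNReal.ofReal (∏ l, fFactor p (linkState p y.1 y.2.1) (linkState p (c + y.1) y.2.2)
        (g l) (dist3 p y.1) (dist3 p (c + y.1))) := by
  have h0 (l : Fin b) := fFactor_nonneg hp (linkState p y.1 y.2.1) (linkState p (c + y.1) y.2.2)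
    (hg l) (dist3_pos hp y.1) (dist3_pos hp (c + y.1))
  have h1 (l : Fin b) := fFactor_le_one hp (linkState p y.1 y.2.1) (linkState p (c + y.1) y.2.2)
    (hg l) (dist3_pos hp y.1) (dist3_pos hp (c + y.1))
  rw [factorExponent, expNeg_sum, ENNReal.ofReal_prod_of_nonneg fun l _ => h0 l]
  exact Finset.prod_congr rfl fun l _ => expNeg_negLog (by simpa using h1 l)

/-! ### The law of the network -/

lemma isProbabilityMeasure_disc {p : Params} (hp : p.Admissible) :
    IsProbabilityMeasure
      (ProbabilityTheory.cond volume (Metric.closedBall (0 : Plane) p.rc)) := by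
  refine cond_isProbabilityMeasure_of_finite ?_ measure_closedBall_lt_top.ne
  exact (Metric.measure_closedBall_pos _ _ hp.rc_pos).ne'

lemma isProbabilityMeasure_markLaw {p : Params} (hp : p.Admissible) :
    IsProbabilityMeasure (markLaw p) := by
  have := isProbabilityMeasure_disc hp
  have : IsProbabilityMeasure (volume.restrict (Icc (0 : ℝ) 1)) := ⟨by simp⟩
  unfold markLaw
  infer_instance

section Network

variable {Ω : Type*} [MeasurableSpace Ω] {μ : Measure Ω} {p : Params}
  {X : ℕ → Ω → Plane} {Y : Option ℕ → Ω → Mark}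

lemma IsNetwork.aemeasurable (hXY : IsNetwork p X Y μ) :
    AEMeasurable (fun ω => ((fun i => X i ω), fun i => Y i ω)) μ :=
  (measurable_pi_lambda _ hXY.poisson.measurable).aemeasurable.prodMk
    (aemeasurable_pi_lambda _ fun i => (hXY.mark_law i).aemeasurable)

variable [IsProbabilityMeasure μ]

lemma IsNetwork.map_eq (hXY : IsNetwork p X Y μ) :
    μ.map (fun ω => ((fun i => X i ω), fun i => Y i ω)) =
      (μ.map fun ω i => X i ω).prod (Measure.infinitePi fun _ : Option ℕ => markLaw p) := by
  have h1 : AEMeasurable (fun ω i => X i ω) μ :=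
    (measurable_pi_lambda _ hXY.poisson.measurable).aemeasurable
  have h2 : AEMeasurable (fun ω i => Y i ω) μ :=
    aemeasurable_pi_lambda _ fun i => (hXY.mark_law i).aemeasurable
  rw [(indepFun_iff_map_prod_eq_prod_map_map h1 h2).1 hXY.centre_mark_indep,
    (iIndepFun.hasLaw_infinitePi hXY.mark_law hXY.mark_indep h2).map_eq]

lemma map_infinitePi_option {E : Type*} [MeasurableSpace E] (ν : Measure E)
    [IsProbabilityMeasure ν] :
    (Measure.infinitePi fun _ : Option ℕ => ν).map
        (fun y => (y none, fun i : ℕ => y (some i))) =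
      ν.prod (Measure.infinitePi fun _ : ℕ => ν) := by
  have hind : iIndepFun (fun i (y : Option ℕ → E) => y i)
      (Measure.infinitePi fun _ : Option ℕ => ν) :=
    iIndepFun_infinitePi (X := fun _ y => y) fun _ => measurable_id
  let S : Set (Option ℕ) := {none}
  have h : IndepFun (fun (y : Option ℕ → E) (k : S) => y k) (fun y (k : (Sᶜ : Set _)) => y k)
      (Measure.infinitePi fun _ : Option ℕ => ν) :=
    indepFun_of_disjoint_of_iIndepFun (fun k => measurable_pi_apply k) hind disjoint_compl_right
  have hm1 : Measurable fun w : S → E => w ⟨none, rfl⟩ := measurable_pi_apply _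
  have hm2 : Measurable fun (w : (Sᶜ : Set _) → E) (i : ℕ) => w ⟨some i, by simp [S]⟩ :=
    measurable_pi_lambda _ fun i => measurable_pi_apply _
  have h1 : IndepFun (fun y : Option ℕ → E => y none) (fun y (i : ℕ) => y (some i))
      (Measure.infinitePi fun _ : Option ℕ => ν) := h.comp hm1 hm2
  rw [(indepFun_iff_map_prod_eq_prod_map_map
      (measurable_pi_apply none).aemeasurable
      (measurable_pi_lambda _ fun i => measurable_pi_apply (some i)).aemeasurable).1 h1,
    Measure.infinitePi_map_eval]
  congr 1
  exact Measure.map_infinitePi_infinitePi_of_inj (Option.some_injective ℕ)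

/-- Expectations over the network, as iterated integrals over the mark of the reference cluster,
the centres, and the marks of the interfering clusters. -/
lemma IsNetwork.lintegral_eq (hp : p.Admissible) (hXY : IsNetwork p X Y μ)
    {H : Mark × (ℕ → Plane) × (ℕ → Mark) → ℝ≥0∞} (hH : Measurable H) :
    ∫⁻ ω, H (Y none ω, (fun i => X i ω), fun i => Y (some i) ω) ∂μ =
      ∫⁻ w, ∫⁻ ω, ∫⁻ y, H (w, (fun i => X i ω), y)
        ∂(Measure.infinitePi fun _ : ℕ => markLaw p) ∂μ ∂(markLaw p) := by
  have := isProbabilityMeasure_markLaw hp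
  have hX : Measurable fun ω i => X i ω := measurable_pi_lambda _ hXY.poisson.measurable
  have : IsProbabilityMeasure (μ.map fun ω i => X i ω) :=
    Measure.isProbabilityMeasure_map hX.aemeasurable
  have hH1 : Measurable fun z : (ℕ → Plane) × (Option ℕ → Mark) =>
      H (z.2 none, z.1, fun i => z.2 (some i)) := hH.comp (by fun_prop)
  have hH2 (x : ℕ → Plane) : Measurable fun y : Mark × (ℕ → Mark) => H (y.1, x, y.2) :=
    hH.comp (by fun_prop)
  have hsplit : Measurable fun y : Option ℕ → Mark => (y none, fun i : ℕ => y (some i)) := by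
    fun_prop
  have hinner (x : ℕ → Plane) : ∫⁻ y, H (y none, x, fun i => y (some i))
      ∂(Measure.infinitePi fun _ : Option ℕ => markLaw p) =
      ∫⁻ w, ∫⁻ y, H (w, x, y) ∂(Measure.infinitePi fun _ : ℕ => markLaw p) ∂(markLaw p) := by
    rw [← lintegral_prod _ (hH2 x).aemeasurable, ← map_infinitePi_option,
      lintegral_map (hH2 x) hsplit]
  have hH3 : Measurable fun z : (Mark × (ℕ → Plane)) × (ℕ → Mark) => H (z.1.1, z.1.2, z.2) :=
    hH.comp (by fun_prop)
  have hH4 := hH3.lintegral_prod_right' (ν := Measure.infinitePi fun _ : ℕ => markLaw p)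
  calc ∫⁻ ω, H (Y none ω, (fun i => X i ω), fun i => Y (some i) ω) ∂μ
      = ∫⁻ z, H (z.2 none, z.1, fun i => z.2 (some i))
          ∂(μ.map (fun ω => ((fun i => X i ω), fun i => Y i ω))) :=
        (lintegral_map' hH1.aemeasurable hXY.aemeasurable).symm
    _ = ∫⁻ x, ∫⁻ w, ∫⁻ y, H (w, x, y) ∂(Measure.infinitePi fun _ : ℕ => markLaw p) ∂(markLaw p)
          ∂(μ.map fun ω i => X i ω) := by
        rw [hXY.map_eq, lintegral_prod _ hH1.aemeasurable]
        exact lintegral_congr hinner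
    _ = ∫⁻ w, ∫⁻ x, ∫⁻ y, H (w, x, y) ∂(Measure.infinitePi fun _ : ℕ => markLaw p)
          ∂(μ.map fun ω i => X i ω) ∂(markLaw p) :=
        -- The reference mark goes outermost because it fixes the coefficients in the Laplace
        -- functional of the other clusters.
        lintegral_lintegral_swap (hH4.comp measurable_swap).aemeasurable
    _ = _ := by
        refine lintegral_congr fun w => ?_
        exact lintegral_map (hH4.comp (by fun_prop : Measurable fun x => (w, x))) hX

/-- The Laplace functional of the Poisson process of cluster centres with independent marks. -/
lemma IsNetwork.lintegral_expNeg_marked (hp : p.Admissible) (hXY : IsNetwork p X Y μ)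
    {φ : Plane → Mark → ℝ≥0∞} (hφ : Measurable fun z : Plane × Mark => φ z.1 z.2) :
    ∫⁻ ω, ∫⁻ y, expNeg (∑' i, φ (X i ω) (y i))
        ∂(Measure.infinitePi fun _ : ℕ => markLaw p) ∂μ =
      expNeg (ENNReal.ofReal p.lam * ∫⁻ c, ∫⁻ y, (1 - expNeg (φ c y)) ∂(markLaw p)) := by
  have := isProbabilityMeasure_markLaw hp
  have hφ1 (c : Plane) : Measurable (φ c) := hφ.comp (by fun_prop : Measurable fun y => (c, y))
  have hind : iIndepFun (fun i (y : ℕ → Mark) => y i)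
      (Measure.infinitePi fun _ : ℕ => markLaw p) :=
    iIndepFun_infinitePi (X := fun _ y => y) fun _ => measurable_id
  -- For fixed centres, averaging over the marks gives a product over the centres, which is again
  -- `expNeg` of a sum of one function of the centre. The unmarked functional applies to that
  -- function.
  have hinner (ω : Ω) : ∫⁻ y, expNeg (∑' i, φ (X i ω) (y i))
      ∂(Measure.infinitePi fun _ : ℕ => markLaw p) =
      expNeg (∑' i, negLog (∫⁻ y, expNeg (φ (X i ω) y) ∂(markLaw p))) := by
    rw [lintegral_expNeg_tsum (Z := fun i (y : ℕ → Mark) => y i) (fun i => measurable_pi_apply i)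
      hind fun i => hφ1 (X i ω)]
    congr 1
    refine tsum_congr fun i => ?_
    have := (measurePreserving_eval_infinitePi (fun _ : ℕ => markLaw p) i).lintegral_comp
      (measurable_expNeg.comp (hφ1 (X i ω)))
    simp only [Function.comp_def, Function.eval] at this
    rw [this]
  have hm : Measurable fun c => ∫⁻ y, expNeg (φ c y) ∂(markLaw p) :=
    (measurable_expNeg.comp hφ).lintegral_prod_right'
  have hle (c : Plane) : ∫⁻ y, expNeg (φ c y) ∂(markLaw p) ≤ 1 := by
    calc _ ≤ ∫⁻ _, 1 ∂(markLaw p) := lintegral_mono fun y => expNeg_le_one _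
      _ = 1 := by simp
  simp_rw [hinner]
  refine (hXY.poisson.lintegral_expNeg (measurable_negLog.comp hm)).trans ?_
  congr 2
  refine lintegral_congr fun c => ?_
  rw [Function.comp_apply, expNeg_negLog (hle c), lintegral_sub
    (g := fun y => expNeg (φ c y)) (measurable_expNeg.comp (hφ1 c))
    ((hle c).trans_lt ENNReal.one_lt_top).ne (ae_of_all _ fun y => expNeg_le_one _)]
  simp

end Network

/-! ### The exponent of the Laplace-type term -/

lemma losProb_nonneg {p : Params} (hp : p.Admissible) (r : ℝ) : 0 ≤ losProb p r := by
  have := hp.envA_pos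
  unfold losProb
  positivity

lemma losProb_le_one {p : Params} (hp : p.Admissible) (r : ℝ) : losProb p r ≤ 1 := by
  have := hp.envA_pos
  unfold losProb
  refine div_le_one_of_le₀ ?_ (by positivity)
  have : 0 ≤ p.envA * Real.exp (-p.envB * (180 / Real.pi * Real.arctan (p.h / r) - p.envA)) := by
    positivity
  linarith

lemma linkProb_nonneg {p : Params} (hp : p.Admissible) (s : LinkState) (r : ℝ) :
    0 ≤ linkProb p s r := by
  cases s
  · exact losProb_nonneg hp r
  · exact sub_nonneg.2 (losProb_le_one hp r)

lemma linkProb_le_one {p : Params} (hp : p.Admissible) (s : LinkState) (r : ℝ) :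
    linkProb p s r ≤ 1 := by
  cases s
  · exact losProb_le_one hp r
  · exact sub_le_self _ (losProb_nonneg hp r)

lemma sum_linkState {M : Type*} [AddCommMonoid M] (f : LinkState → M) :
    ∑ s, f s = f .los + f .nlos := by
  have : (Finset.univ : Finset LinkState) = {.los, .nlos} := rfl
  rw [this, Finset.sum_pair (by simp)]

/-- Averaging over the number that decides the state of a link. -/
lemma lintegral_linkState {p : Params} (hp : p.Admissible) (v : Plane) (f : LinkState → ℝ≥0∞) :
    ∫⁻ u in Icc (0 : ℝ) 1, f (linkState p v u) =
      ∑ s, ENNReal.ofReal (linkProb p s ‖v‖) * f s := by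
  have h0 := losProb_nonneg hp ‖v‖
  have h1 := losProb_le_one hp ‖v‖
  set L := losProb p ‖v‖ with hL
  have hunion : Icc (0 : ℝ) 1 = Icc 0 L ∪ Ioc L 1 := (Icc_union_Ioc_eq_Icc h0 h1).symm
  have hdisj : Disjoint (Icc 0 L) (Ioc L 1) :=
    Set.disjoint_left.2 fun u hu hu' => absurd hu.2 (not_le.2 hu'.1)
  rw [hunion, lintegral_union measurableSet_Ioc hdisj, sum_linkState]
  have e1 : ∫⁻ u in Icc 0 L, f (linkState p v u) = ∫⁻ _ in Icc 0 L, f .los :=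
    setLIntegral_congr_fun measurableSet_Icc fun u hu => by
      simp [linkState, ← hL, hu.2]
  have e2 : ∫⁻ u in Ioc L 1, f (linkState p v u) = ∫⁻ _ in Ioc L 1, f .nlos :=
    setLIntegral_congr_fun measurableSet_Ioc fun u hu => by
      simp [linkState, ← hL, not_le.2 hu.1]
  rw [e1, e2, setLIntegral_const, setLIntegral_const, Real.volume_Icc, Real.volume_Ioc, sub_zero,
    mul_comm, mul_comm (f .nlos)]
  rfl

/-- Averaging over the mark of a cluster, with its second number deciding the state of a link with
horizontal displacement `c`. -/
lemma lintegral_markLaw {p : Params} (hp : p.Admissible) (c : Plane)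
    {F : LinkState → LinkState → Plane → ℝ≥0∞} (hF : ∀ e j, Measurable (F e j)) :
    ∫⁻ y, F (linkState p y.1 y.2.1) (linkState p c y.2.2) y.1 ∂(markLaw p) =
      ∑ e, ∑ j, ∫⁻ v, ENNReal.ofReal (linkProb p e ‖v‖ * linkProb p j ‖c‖) * F e j v
        ∂(ProbabilityTheory.cond volume (Metric.closedBall (0 : Plane) p.rc)) := by
  have := isProbabilityMeasure_disc hp
  have hm (e j : LinkState) : Measurable fun v : Plane =>
      ENNReal.ofReal (linkProb p e ‖v‖ * linkProb p j ‖c‖) * F e j v :=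
    (((measurable_linkProb p e).comp measurable_norm).mul_const _).ennreal_ofReal.mul (hF e j)
  have hmeas : Measurable fun y : Mark =>
      F (linkState p y.1 y.2.1) (linkState p c y.2.2) y.1 := by
    refine measurable_linkState p (f := fun e (y : Mark) => F e (linkState p c y.2.2) y.1)
      (by fun_prop) (by fun_prop) fun e => ?_
    exact measurable_linkState p (f := fun j (y : Mark) => F e j y.1)
      (by fun_prop) (by fun_prop) fun j => (hF e j).comp measurable_fst
  have hmeas2 (v : Plane) : Measurable fun u : ℝ × ℝ =>
      F (linkState p v u.1) (linkState p c u.2) v := hmeas.comp (by fun_prop : Measurable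
        fun u : ℝ × ℝ => ((v, u) : Mark))
  rw [markLaw, lintegral_prod _ hmeas.aemeasurable]
  have hv (v : Plane) : ∫⁻ u : ℝ × ℝ, F (linkState p v u.1) (linkState p c u.2) v
      ∂((volume.restrict (Icc (0 : ℝ) 1)).prod (volume.restrict (Icc (0 : ℝ) 1))) =
      ∑ e, ∑ j, ENNReal.ofReal (linkProb p e ‖v‖ * linkProb p j ‖c‖) * F e j v := by
    rw [lintegral_prod _ (hmeas2 v).aemeasurable]
    refine (lintegral_congr fun u =>
      lintegral_linkState hp c fun j => F (linkState p v u) j v).trans ?_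
    rw [lintegral_linkState hp v
      fun e => ∑ j, ENNReal.ofReal (linkProb p j ‖c‖) * F e j v]
    refine Finset.sum_congr rfl fun e _ => ?_
    rw [Finset.mul_sum]
    refine Finset.sum_congr rfl fun j _ => ?_
    rw [ENNReal.ofReal_mul (linkProb_nonneg hp _ _), mul_assoc]
  simp_rw [hv]
  rw [lintegral_finsetSum _ fun e _ => Finset.measurable_sum _ fun j _ => hm e j]
  refine Finset.sum_congr rfl fun e _ => ?_
  rw [lintegral_finsetSum _ fun j _ => hm e j]

/-- Integration over the centre and the mark of an interfering cluster, in terms of the positions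
of its user relative to the reference UAV and to its own UAV. -/
lemma lintegral_user {p : Params} (hp : p.Admissible)
    {F : LinkState → LinkState → Plane → Plane → ℝ≥0∞}
    (hF : ∀ e j, Measurable fun z : Plane × Plane => F e j z.1 z.2) :
    ∫⁻ c, ∫⁻ y, F (linkState p y.1 y.2.1) (linkState p (c + y.1) y.2.2) (c + y.1) y.1
        ∂(markLaw p) =
      ∑ e, ∑ j, ∫⁻ c, ∫⁻ v, ENNReal.ofReal (linkProb p e ‖v‖ * linkProb p j ‖c‖) * F e j c v
        ∂(ProbabilityTheory.cond volume (Metric.closedBall (0 : Plane) p.rc)) := by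
  have hprob := isProbabilityMeasure_markLaw hp
  have hprob' := isProbabilityMeasure_disc hp
  have hFm : Measurable fun z : Plane × Mark =>
      F (linkState p z.2.1 z.2.2.1) (linkState p z.1 z.2.2.2) z.1 z.2.1 := by
    refine measurable_linkState p (f := fun e (z : Plane × Mark) =>
      F e (linkState p z.1 z.2.2.2) z.1 z.2.1) (by fun_prop) (by fun_prop) fun e => ?_
    refine measurable_linkState p (f := fun j (z : Plane × Mark) =>
      F e j z.1 z.2.1) (by fun_prop) (by fun_prop) fun j => ?_
    exact (hF e j).comp (by fun_prop : Measurable fun z : Plane × Mark => (z.1, z.2.1))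
  have hFc (c : Plane) (e j : LinkState) : Measurable (F e j c) :=
    (hF e j).comp (by fun_prop : Measurable fun v : Plane => (c, v))
  have hKm (e j : LinkState) : Measurable fun c : Plane =>
      ∫⁻ v, ENNReal.ofReal (linkProb p e ‖v‖ * linkProb p j ‖c‖) * F e j c v
        ∂(ProbabilityTheory.cond volume (Metric.closedBall (0 : Plane) p.rc)) := by
    have h : Measurable fun z : Plane × Plane =>
        ENNReal.ofReal (linkProb p e ‖z.2‖ * linkProb p j ‖z.1‖) * F e j z.1 z.2 :=
      (((measurable_linkProb p e).comp measurable_snd.norm).mul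
        ((measurable_linkProb p j).comp measurable_fst.norm)).ennreal_ofReal.mul (hF e j)
    exact h.lintegral_prod_right'
  calc ∫⁻ c, ∫⁻ y, F (linkState p y.1 y.2.1) (linkState p (c + y.1) y.2.2) (c + y.1) y.1
        ∂(markLaw p)
      = ∫⁻ y, ∫⁻ c, F (linkState p y.1 y.2.1) (linkState p (c + y.1) y.2.2) (c + y.1) y.1
          ∂volume ∂(markLaw p) := by
        refine lintegral_lintegral_swap (Measurable.aemeasurable ?_)
        exact hFm.comp (by fun_prop : Measurable fun z : Plane × Mark => (z.1 + z.2.1, z.2))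
    _ = ∫⁻ y, ∫⁻ c, F (linkState p y.1 y.2.1) (linkState p c y.2.2) c y.1
          ∂volume ∂(markLaw p) :=
        -- For a fixed displacement, the user's position is a translate of the centre, and Lebesgue
        -- measure does not change.
        lintegral_congr fun y => lintegral_add_right_eq_self
          (fun c => F (linkState p y.1 y.2.1) (linkState p c y.2.2) c y.1) y.1
    _ = ∫⁻ c, ∫⁻ y, F (linkState p y.1 y.2.1) (linkState p c y.2.2) c y.1 ∂(markLaw p) :=
        (lintegral_lintegral_swap hFm.aemeasurable).symm
    _ = ∫⁻ c : Plane, ∑ e, ∑ j, ∫⁻ v,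
          ENNReal.ofReal (linkProb p e ‖v‖ * linkProb p j ‖c‖) * F e j c v
          ∂(ProbabilityTheory.cond volume (Metric.closedBall (0 : Plane) p.rc)) :=
        lintegral_congr fun c => lintegral_markLaw hp c (F := fun e j v => F e j c v) (hFc c)
    _ = _ := by
        rw [lintegral_finsetSum _ fun e _ => Finset.measurable_sum _ fun j _ => hKm e j]
        exact Finset.sum_congr rfl fun e _ => lintegral_finsetSum _ fun j _ => hKm e j

lemma one_sub_prod_le_sum {ι : Type*} (s : Finset ι) (f : ι → ℝ) (h0 : ∀ i ∈ s, 0 ≤ f i)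
    (h1 : ∀ i ∈ s, f i ≤ 1) : 1 - ∏ i ∈ s, f i ≤ ∑ i ∈ s, (1 - f i) := by
  classical
  induction s using Finset.induction_on with
  | empty => simp
  | insert a s ha ih =>
    rw [Finset.prod_insert ha, Finset.sum_insert ha]
    have h2 := ih (fun i hi => h0 i (Finset.mem_insert_of_mem hi))
      fun i hi => h1 i (Finset.mem_insert_of_mem hi)
    have h3 := h0 a (Finset.mem_insert_self a s)
    have h4 := h1 a (Finset.mem_insert_self a s)
    have h5 : ∏ i ∈ s, f i ≤ 1 := Finset.prod_le_one
      (fun i hi => h0 i (Finset.mem_insert_of_mem hi))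
      fun i hi => h1 i (Finset.mem_insert_of_mem hi)
    nlinarith

/-- Bernoulli's inequality gives the bound `m y / (m + y)`, which is at most `y`. Together with
`one_sub_prod_le_sum` this bounds the kernel linearly in the path loss. -/
lemma one_sub_div_pow_le {m : ℕ} (hm : 1 ≤ m) {y : ℝ} (hy : 0 ≤ y) :
    1 - ((m : ℝ) / (m + y)) ^ m ≤ y := by
  have hm0 : (0 : ℝ) < m := by positivity
  have h1 := one_add_mul_le_pow (a := (m : ℝ) / (m + y) - 1)
    (by have : 0 ≤ (m : ℝ) / (m + y) := by positivity
        linarith) m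
  have h2 : (m : ℝ) * ((m : ℝ) / (m + y) - 1) = -(y * (m / (m + y))) := by
    field_simp
    ring
  have h3 : (m : ℝ) / (m + y) ≤ 1 := div_le_one_of_le₀ (by linarith) (by positivity)
  rw [h2, add_sub_cancel] at h1
  nlinarith

section Exponent

variable {p : Params} (hp : p.Admissible) {b : ℕ} {g : Fin b → ℝ} (hg : ∀ l, 0 ≤ g l)

/-- Comparison with `1 + ‖v‖²`, using `min 1 h² * (1 + ‖v‖²) ≤ ‖v‖² + h²`. The condition `a > 2` is
integrability at infinity in dimension two. -/
lemma integrable_sq_add_sq_rpow {h a : ℝ} (hh : 0 < h) (ha : 2 < a) :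
    Integrable fun v : Plane => (‖v‖ ^ 2 + h ^ 2) ^ (-a / 2) := by
  have h1 := integrable_rpow_neg_one_add_norm_sq (E := Plane) (μ := volume) (r := a)
    (by simpa using ha)
  have hc : 0 < min 1 (h ^ 2) := by positivity
  refine (h1.const_mul ((min 1 (h ^ 2)) ^ (-a / 2))).mono' ?_ (ae_of_all _ fun v => ?_)
  · exact (by fun_prop : Measurable fun v : Plane =>
      (‖v‖ ^ 2 + h ^ 2) ^ (-a / 2)).aestronglyMeasurable
  · rw [Real.norm_of_nonneg (by positivity), ← Real.mul_rpow hc.le (by positivity)]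
    refine Real.rpow_le_rpow_of_nonpos (by positivity) ?_ (by linarith)
    have e1 := min_le_left 1 (h ^ 2)
    have e2 := min_le_right 1 (h ^ 2)
    nlinarith [sq_nonneg ‖v‖]

variable (p g) in
/-- The integrand of the exponent of the Laplace-type term, in terms of horizontal distances. -/
noncomputable def exponentKernel (e j : LinkState) (t u : ℝ) : ℝ :=
  linkProb p e u * linkProb p j t *
    (1 - ∏ l, fFactor p e j (g l) (Real.sqrt (u ^ 2 + p.h ^ 2)) (Real.sqrt (t ^ 2 + p.h ^ 2)))

lemma measurable_exponentKernel (e j : LinkState) :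
    Measurable fun z : ℝ × ℝ => exponentKernel p g e j z.1 z.2 := by
  unfold exponentKernel
  refine (((measurable_linkProb p e).comp measurable_snd).mul
    ((measurable_linkProb p j).comp measurable_fst)).mul (measurable_const.sub ?_)
  refine Finset.measurable_prod _ fun l _ => ?_
  exact (measurable_fFactor p e j).comp (f := fun z : ℝ × ℝ =>
    (g l, Real.sqrt (z.2 ^ 2 + p.h ^ 2), Real.sqrt (z.1 ^ 2 + p.h ^ 2))) (by fun_prop)

include hp hg

lemma prod_fFactor_mem (e j : LinkState) {R D : ℝ} (hR : 0 < R) (hD : 0 < D) :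
    ∏ l, fFactor p e j (g l) R D ∈ Icc 0 1 :=
  ⟨Finset.prod_nonneg fun l _ => fFactor_nonneg hp e j (hg l) hR hD,
    Finset.prod_le_one (fun l _ => fFactor_nonneg hp e j (hg l) hR hD)
      fun l _ => fFactor_le_one hp e j (hg l) hR hD⟩

lemma exponentKernel_nonneg (e j : LinkState) (t u : ℝ) : 0 ≤ exponentKernel p g e j t u := by
  have hh := hp.h_pos
  refine mul_nonneg (mul_nonneg (linkProb_nonneg hp e _) (linkProb_nonneg hp j _)) ?_
  exact sub_nonneg.2 (prod_fFactor_mem hp hg e j (Real.sqrt_pos.2 (by positivity))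
    (Real.sqrt_pos.2 (by positivity))).2

/-- An integrable majorant, uniform over the disc. The distance to the own UAV may be replaced by
its maximum because its exponent `α ε` is nonnegative. -/
lemma exponentKernel_le (e j : LinkState) (t : ℝ) {u : ℝ} (hu : 0 ≤ u) (hu' : u ≤ p.rc) :
    exponentKernel p g e j t u ≤
      (∑ l, g l * p.rho e * p.eta j * Real.sqrt (p.rc ^ 2 + p.h ^ 2) ^ (p.alpha e * p.eps e)) *
        (t ^ 2 + p.h ^ 2) ^ (-p.alpha j / 2) := by
  have hh := hp.h_pos
  have h1 := hp.rho_pos e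
  have h2 := hp.eta_pos j
  have h3 := hp.eps_nonneg e
  have h4 := hp.two_lt_alpha e
  have hR : 0 < Real.sqrt (u ^ 2 + p.h ^ 2) := Real.sqrt_pos.2 (by positivity)
  have hD : 0 < Real.sqrt (t ^ 2 + p.h ^ 2) := Real.sqrt_pos.2 (by positivity)
  have hRle : Real.sqrt (u ^ 2 + p.h ^ 2) ≤ Real.sqrt (p.rc ^ 2 + p.h ^ 2) := by gcongr
  have hDeq : Real.sqrt (t ^ 2 + p.h ^ 2) ^ (-p.alpha j) =
      (t ^ 2 + p.h ^ 2) ^ (-p.alpha j / 2) := by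
    rw [Real.sqrt_eq_rpow, ← Real.rpow_mul (by positivity)]
    ring_nf
  have hmem := prod_fFactor_mem hp hg e j hR hD
  calc exponentKernel p g e j t u
      ≤ 1 * (1 - ∏ l, fFactor p e j (g l) (Real.sqrt (u ^ 2 + p.h ^ 2))
          (Real.sqrt (t ^ 2 + p.h ^ 2))) := by
        refine mul_le_mul_of_nonneg_right ?_ (sub_nonneg.2 hmem.2)
        exact mul_le_one₀ (linkProb_le_one hp e _) (linkProb_nonneg hp j _)
          (linkProb_le_one hp j _)
    _ ≤ ∑ l, (1 - fFactor p e j (g l) (Real.sqrt (u ^ 2 + p.h ^ 2))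
          (Real.sqrt (t ^ 2 + p.h ^ 2))) := by
        rw [one_mul]
        exact one_sub_prod_le_sum _ _ (fun l _ => fFactor_nonneg hp e j (hg l) hR hD)
          fun l _ => fFactor_le_one hp e j (hg l) hR hD
    _ ≤ ∑ l, (g l * p.rho e * p.eta j *
          Real.sqrt (p.rc ^ 2 + p.h ^ 2) ^ (p.alpha e * p.eps e)) *
            (t ^ 2 + p.h ^ 2) ^ (-p.alpha j / 2) := by
        refine Finset.sum_le_sum fun l _ => ?_
        have hgl := hg l
        refine (one_sub_div_pow_le (hp.m_pos j) (by positivity)).trans ?_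
        rw [← hDeq]
        have : 0 ≤ p.alpha e * p.eps e := by positivity
        gcongr
    _ = _ := (Finset.sum_mul _ _ _).symm

/-- Each summand of the exponent of the Laplace-type term, as an integral over the plane. -/
lemma lintegral_exponentKernel (e j : LinkState) :
    ∫⁻ c : Plane, ∫⁻ v, ENNReal.ofReal (exponentKernel p g e j ‖c‖ ‖v‖)
        ∂(ProbabilityTheory.cond volume (Metric.closedBall (0 : Plane) p.rc)) =
      ENNReal.ofReal (2 * Real.pi * ∫ z in Ioi p.h, ∫ r in p.h..Real.sqrt (p.h ^ 2 + p.rc ^ 2),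
        (1 - ∏ i, fFactor p e j (g i) r z) * z *
          linkProb p e (Real.sqrt (r ^ 2 - p.h ^ 2)) *
          linkProb p j (Real.sqrt (z ^ 2 - p.h ^ 2)) * distDensity p r) ∧
    0 ≤ ∫ z in Ioi p.h, ∫ r in p.h..Real.sqrt (p.h ^ 2 + p.rc ^ 2),
        (1 - ∏ i, fFactor p e j (g i) r z) * z *
          linkProb p e (Real.sqrt (r ^ 2 - p.h ^ 2)) *
          linkProb p j (Real.sqrt (z ^ 2 - p.h ^ 2)) * distDensity p r := by
  have hh := hp.h_pos
  have hprob := isProbabilityMeasure_disc hp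
  set ν := ProbabilityTheory.cond volume (Metric.closedBall (0 : Plane) p.rc) with hν
  let C := ∑ l, g l * p.rho e * p.eta j *
    Real.sqrt (p.rc ^ 2 + p.h ^ 2) ^ (p.alpha e * p.eps e)
  let J : ℝ → ℝ := fun t => ∫ v, exponentKernel p g e j t ‖v‖ ∂ν
  have hsupp : ∀ᵐ v ∂ν, ‖v‖ ≤ p.rc := by
    have h1 : ∀ᵐ v ∂(volume.restrict (Metric.closedBall (0 : Plane) p.rc)), ‖v‖ ≤ p.rc := by
      filter_upwards [ae_restrict_mem measurableSet_closedBall] with v hv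
      simpa using hv
    rw [hν, ProbabilityTheory.cond]
    exact Measure.ae_smul_measure h1 _
  have hbound (t : ℝ) : ∀ᵐ v ∂ν, exponentKernel p g e j t ‖v‖ ≤
      C * (t ^ 2 + p.h ^ 2) ^ (-p.alpha j / 2) := by
    filter_upwards [hsupp] with v hv
    exact exponentKernel_le hp hg e j t (norm_nonneg v) hv
  have hmeas (t : ℝ) : Measurable fun v : Plane => exponentKernel p g e j t ‖v‖ :=
    (measurable_exponentKernel e j).comp (by fun_prop : Measurable fun v : Plane => (t, ‖v‖))
  have hint (t : ℝ) : Integrable (fun v => exponentKernel p g e j t ‖v‖) ν := by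
    refine Integrable.of_bound (hmeas t).aestronglyMeasurable
      (C * (t ^ 2 + p.h ^ 2) ^ (-p.alpha j / 2)) ?_
    filter_upwards [hbound t] with v hv
    rwa [Real.norm_of_nonneg (exponentKernel_nonneg hp hg e j _ _)]
  have hJ0 (t : ℝ) : 0 ≤ J t := integral_nonneg fun v => exponentKernel_nonneg hp hg e j _ _
  have hJle (t : ℝ) : J t ≤ C * (t ^ 2 + p.h ^ 2) ^ (-p.alpha j / 2) := by
    refine (integral_mono_ae (hint t) (integrable_const _) (hbound t)).trans ?_
    simp
  have hJm : Measurable fun c : Plane => J ‖c‖ := by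
    have h1 : Measurable fun z : Plane × Plane => exponentKernel p g e j ‖z.1‖ ‖z.2‖ :=
      (measurable_exponentKernel e j).comp
        (by fun_prop : Measurable fun z : Plane × Plane => (‖z.1‖, ‖z.2‖))
    exact (h1.stronglyMeasurable.integral_prod_right (ν := ν)).measurable
  -- Integrability ensures that the real integral in the formula has its true value rather than the
  -- default `0`, so it agrees with the integral in `[0, ∞]`.
  have hJint : Integrable fun c : Plane => J ‖c‖ := by
    refine ((integrable_sq_add_sq_rpow hh (hp.two_lt_alpha j)).const_mul C).mono'
      hJm.aestronglyMeasurable (ae_of_all _ fun c => ?_)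
    rw [Real.norm_of_nonneg (hJ0 _)]
    exact hJle _
  have hinner (c : Plane) : ∫⁻ v, ENNReal.ofReal (exponentKernel p g e j ‖c‖ ‖v‖) ∂ν =
      ENNReal.ofReal (J ‖c‖) :=
    (ofReal_integral_eq_lintegral_ofReal (hint _)
      (ae_of_all _ fun v => exponentKernel_nonneg hp hg e j _ _)).symm
  have hsqrt : Real.sqrt (p.rc ^ 2 + p.h ^ 2) = Real.sqrt (p.h ^ 2 + p.rc ^ 2) := by
    rw [add_comm]
  have hle : p.h ≤ Real.sqrt (p.h ^ 2 + p.rc ^ 2) :=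
    Real.le_sqrt_of_sq_le (by nlinarith [sq_nonneg p.rc])
  have hback (z : ℝ) (hz : p.h ≤ z) :
      Real.sqrt (Real.sqrt (z ^ 2 - p.h ^ 2) ^ 2 + p.h ^ 2) = z := by
    rw [Real.sq_sqrt (by nlinarith), sub_add_cancel, Real.sqrt_sq (hh.le.trans hz)]
  have hK : ∫ z in Ioi p.h, z * J (Real.sqrt (z ^ 2 - p.h ^ 2)) =
      ∫ z in Ioi p.h, ∫ r in p.h..Real.sqrt (p.h ^ 2 + p.rc ^ 2),
        (1 - ∏ i, fFactor p e j (g i) r z) * z *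
          linkProb p e (Real.sqrt (r ^ 2 - p.h ^ 2)) *
          linkProb p j (Real.sqrt (z ^ 2 - p.h ^ 2)) * distDensity p r := by
    refine setIntegral_congr_fun measurableSet_Ioi fun z hz => ?_
    simp only [J]
    rw [hν, integral_disc_radial hp, ← intervalIntegral.integral_const_mul, hsqrt]
    refine intervalIntegral.integral_congr fun r hr => ?_
    rw [uIcc_of_le hle] at hr
    simp only [exponentKernel]
    rw [hback z (le_of_lt hz), hback r hr.1]
    ring
  simp_rw [hinner]
  rw [← ofReal_integral_eq_lintegral_ofReal hJint (ae_of_all _ fun c => hJ0 _),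
    integral_plane_radial hh J, hK]
  refine ⟨rfl, ?_⟩
  rw [← hK]
  exact setIntegral_nonneg measurableSet_Ioi fun z hz => mul_nonneg (hh.le.trans (le_of_lt hz))
    (hJ0 _)

/-- The Laplace-type term without noise is the Laplace functional of the marked Poisson process. -/
theorem ofReal_laplaceTerm : ENNReal.ofReal (laplaceTerm p g) =
    ENNReal.ofReal (Real.exp (-((∑ l, g l) * p.noise))) *
      expNeg (ENNReal.ofReal p.lam *
        ∫⁻ c, ∫⁻ y, (1 - expNeg (factorExponent p g c y)) ∂(markLaw p)) := by
  have hF (e j : LinkState) : Measurable fun z : Plane × Plane =>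
      ENNReal.ofReal (1 - ∏ l, fFactor p e j (g l) (dist3 p z.2) (dist3 p z.1)) := by
    refine (measurable_const.sub (Finset.measurable_prod _ fun l _ => ?_)).ennreal_ofReal
    exact (measurable_fFactor p e j).comp (f := fun z : Plane × Plane =>
      (g l, dist3 p z.2, dist3 p z.1)) (by fun_prop)
  have h1 (c : Plane) (y : Mark) : 1 - expNeg (factorExponent p g c y) =
      ENNReal.ofReal (1 - ∏ l, fFactor p (linkState p y.1 y.2.1) (linkState p (c + y.1) y.2.2)
        (g l) (dist3 p y.1) (dist3 p (c + y.1))) := by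
    have h := (prod_fFactor_mem hp hg (linkState p y.1 y.2.1) (linkState p (c + y.1) y.2.2)
      (dist3_pos hp y.1) (dist3_pos hp (c + y.1))).1
    rw [expNeg_factorExponent hp hg, ← ENNReal.ofReal_one, ← ENNReal.ofReal_sub 1 h]
  have h2 : ∫⁻ c, ∫⁻ y, (1 - expNeg (factorExponent p g c y)) ∂(markLaw p) =
      ∑ e, ∑ j, ∫⁻ c : Plane, ∫⁻ v, ENNReal.ofReal (exponentKernel p g e j ‖c‖ ‖v‖)
        ∂(ProbabilityTheory.cond volume (Metric.closedBall (0 : Plane) p.rc)) := by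
    simp_rw [h1]
    rw [lintegral_user hp (F := fun e j c v =>
      ENNReal.ofReal (1 - ∏ l, fFactor p e j (g l) (dist3 p v) (dist3 p c))) hF]
    refine Finset.sum_congr rfl fun e _ => Finset.sum_congr rfl fun j _ =>
      lintegral_congr fun c => lintegral_congr fun v => ?_
    rw [← ENNReal.ofReal_mul (mul_nonneg (linkProb_nonneg hp _ _) (linkProb_nonneg hp _ _))]
    rfl
  have hlam := hp.lam_pos
  have hA (e j : LinkState) := (lintegral_exponentKernel hp hg e j).2
  rw [h2, laplaceTerm, ENNReal.ofReal_mul (Real.exp_nonneg _)]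
  simp_rw [(lintegral_exponentKernel hp hg _ _).1]
  simp_rw [← ENNReal.ofReal_sum_of_nonneg
    fun j _ => mul_nonneg Real.two_pi_pos.le (hA _ j)]
  rw [← ENNReal.ofReal_sum_of_nonneg fun e _ => Finset.sum_nonneg
      fun j _ => mul_nonneg Real.two_pi_pos.le (hA e j),
    ← ENNReal.ofReal_mul hlam.le, expNeg_ofReal (mul_nonneg hlam.le (Finset.sum_nonneg fun e _ =>
      Finset.sum_nonneg fun j _ => mul_nonneg Real.two_pi_pos.le (hA e j)))]
  congr 3
  simp_rw [← Finset.mul_sum]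
  ring

end Exponent

/-! ### Moments -/

/-- One term of the expansion of the `b`-th power of the approximate conditional success
probability, as a function of the mark of the reference cluster, the centres of the interfering
clusters and their marks. -/
noncomputable def momentTerm (p : Params) (s : LinkState) (θ : ℝ) {b : ℕ} (k : Fin b → ℕ)
    (z : Mark × (ℕ → Plane) × (ℕ → Mark)) : ℝ≥0∞ :=
  if linkState p z.1.1 z.1.2.1 = s then
    ENNReal.ofReal (Real.exp (-((∑ l, gCoeff p s θ (k l) (dist3 p z.1.1)) * p.noise))) *
      expNeg (∑' i, factorExponent p (fun l => gCoeff p s θ (k l) (dist3 p z.1.1))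
        (z.2.1 i) (z.2.2 i))
  else 0

lemma measurable_momentTerm (p : Params) (s : LinkState) (θ : ℝ) {b : ℕ} (k : Fin b → ℕ) :
    Measurable (momentTerm p s θ k) := by
  have hg (l : Fin b) : Measurable fun z : Mark × (ℕ → Plane) × (ℕ → Mark) =>
      gCoeff p s θ (k l) (dist3 p z.1.1) := (measurable_gCoeff p s θ (k l)).comp (by fun_prop)
  refine measurable_linkState p (f := fun e (z : Mark × (ℕ → Plane) × (ℕ → Mark)) =>
    if e = s then
      ENNReal.ofReal (Real.exp (-((∑ l, gCoeff p s θ (k l) (dist3 p z.1.1)) * p.noise))) *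
        expNeg (∑' i, factorExponent p (fun l => gCoeff p s θ (k l) (dist3 p z.1.1))
          (z.2.1 i) (z.2.2 i))
    else 0) (by fun_prop) (by fun_prop) fun e => ?_
  split_ifs
  · refine Measurable.mul (by fun_prop) (measurable_expNeg.comp (Measurable.tsum fun i => ?_))
    exact measurable_factorExponent_comp p (measurable_pi_lambda _ hg) (by fun_prop) (by fun_prop)
  · exact measurable_const

lemma sum_pow_eq_sum_piFinset (S : Finset ℕ) (a : ℕ → ℝ) (b : ℕ) :
    (∑ n ∈ S, a n) ^ b = ∑ k ∈ Fintype.piFinset (fun _ : Fin b => S), ∏ l, a (k l) := by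
  simpa using Finset.prod_univ_sum (fun _ : Fin b => S) (fun _ n => a n)

section Moments

variable {p : Params} (hp : p.Admissible) {s : LinkState} {θ : ℝ} (hθ : 0 < θ)
  {b : ℕ} (k : Fin b → ℕ)
include hp hθ

lemma momentTerm_le_one (z : Mark × (ℕ → Plane) × (ℕ → Mark)) : momentTerm p s θ k z ≤ 1 := by
  unfold momentTerm
  split_ifs
  · refine mul_le_one' ?_ (expNeg_le_one _)
    rw [ENNReal.ofReal_le_one, Real.exp_le_one_iff, neg_nonpos]
    exact mul_nonneg (Finset.sum_nonneg fun l _ => gCoeff_nonneg hp s hθ _ (dist3_pos hp _))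
      hp.noise_pos.le
  · exact zero_le_one

/-- Expansion of the `b`-th power of the approximate conditional success probability. -/
lemma approxSuccessOn_pow (hb : 1 ≤ b) (x : Realization) : approxSuccessOn p s θ x ^ b =
    ∑ k ∈ Fintype.piFinset (fun _ : Fin b => Finset.Icc 1 (p.m s)),
      (∏ i, ((p.m s).choose (k i) : ℝ)) * (-1) ^ ((∑ i, k i) + b) *
        (momentTerm p s θ k (x.mark none, x.centre, fun i => x.mark (some i))).toReal := by
  by_cases hs : x.ownState p none = s
  · have hs' : linkState p (x.mark none).1 (x.mark none).2.1 = s := hs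
    have hR (i : ℕ) : 0 < x.R p (some i) := dist3_pos hp _
    have hD (i : ℕ) : 0 < x.D p i := dist3_pos hp _
    have hg (n : ℕ) := gCoeff_nonneg hp s hθ n (dist3_pos hp (x.mark none).1)
    rw [approxSuccessOn, if_pos hs, sum_pow_eq_sum_piFinset]
    refine Finset.sum_congr rfl fun k _ => ?_
    have hprod : ∏ l, ∏' i : ℕ, fFactor p (x.ownState p (some i)) (x.refState p i)
        (gCoeff p s θ (k l) (x.R p none)) (x.R p (some i)) (x.D p i) =
        (expNeg (∑' i, factorExponent p (fun l => gCoeff p s θ (k l) (dist3 p (x.mark none).1))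
          (x.centre i) (x.mark (some i)))).toReal := by
      simp_rw [factorExponent]
      rw [Summable.tsum_finsetSum (f := fun (l : Fin b) (i : ℕ) => (_ : ℝ≥0∞))
        fun l _ => ENNReal.summable, expNeg_sum, ENNReal.toReal_prod]
      exact Finset.prod_congr rfl fun l _ => tprod_eq_expNeg_tsum _
        (fun i => fFactor_nonneg hp _ _ (hg _) (hR i) (hD i))
        (fun i => fFactor_le_one hp _ _ (hg _) (hR i) (hD i))
    -- The signs `(-1) ^ (k l + 1)` multiply to `(-1) ^ (∑ k + b)`, and the noise exponents add up.
    rw [Finset.prod_mul_distrib, Finset.prod_mul_distrib, Finset.prod_mul_distrib, hprod,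
      momentTerm, if_pos hs', ENNReal.toReal_mul, ENNReal.toReal_ofReal (Real.exp_nonneg _),
      Finset.prod_pow_eq_pow_sum, ← Real.exp_sum, Finset.sum_add_distrib, Finset.sum_neg_distrib,
      ← Finset.sum_mul]
    simp only [Finset.sum_const, Finset.card_univ, Fintype.card_fin, smul_eq_mul, mul_one]
    rw [mul_assoc]
    rfl
  · have hs' : ¬ linkState p (x.mark none).1 (x.mark none).2.1 = s := hs
    simp [approxSuccessOn, momentTerm, hs, hs', Nat.one_le_iff_ne_zero.1 hb]

omit hθ in
/-- Averaging over the mark of the reference cluster. -/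
lemma lintegral_markLaw_own {F : Plane → ℝ≥0∞} (hF : Measurable F) :
    ∫⁻ w, (if linkState p w.1 w.2.1 = s then F w.1 else 0) ∂(markLaw p) =
      ∫⁻ v, ENNReal.ofReal (linkProb p s ‖v‖) * F v
        ∂(ProbabilityTheory.cond volume (Metric.closedBall (0 : Plane) p.rc)) := by
  have hm : Measurable fun w : Mark => if linkState p w.1 w.2.1 = s then F w.1 else 0 := by
    refine measurable_linkState p (f := fun e (w : Mark) => if e = s then F w.1 else 0)
      (by fun_prop) (by fun_prop) fun e => ?_
    split_ifs
    · exact hF.comp measurable_fst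
    · exact measurable_const
  rw [markLaw, lintegral_prod _ hm.aemeasurable]
  refine lintegral_congr fun v => ?_
  have hm2 : Measurable fun u : ℝ × ℝ => if linkState p v u.1 = s then F v else 0 :=
    hm.comp (by fun_prop : Measurable fun u : ℝ × ℝ => ((v, u) : Mark))
  rw [lintegral_prod _ hm2.aemeasurable]
  have h1 (u : ℝ) : ∫⁻ _ in Icc (0 : ℝ) 1, (if linkState p v u = s then F v else 0) =
      if linkState p v u = s then F v else 0 := by
    rw [setLIntegral_const]
    simp
  refine (lintegral_congr h1).trans ?_
  rw [lintegral_linkState hp v fun e => if e = s then F v else 0]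
  simp

/-- Measurability is read off from the Laplace functional, an integral in `[0, ∞]` depending
measurably on a parameter. -/
lemma measurable_ofReal_laplaceTerm : Measurable fun v : Plane =>
    ENNReal.ofReal (laplaceTerm p fun l => gCoeff p s θ (k l) (dist3 p v)) := by
  have hprob := isProbabilityMeasure_markLaw hp
  have hg (l : Fin b) : Measurable fun v : Plane => gCoeff p s θ (k l) (dist3 p v) :=
    (measurable_gCoeff p s θ (k l)).comp (by fun_prop)
  have h1 (v : Plane) := ofReal_laplaceTerm hp (g := fun l => gCoeff p s θ (k l) (dist3 p v))
    fun l => gCoeff_nonneg hp s hθ _ (dist3_pos hp v)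
  simp_rw [h1]
  refine Measurable.mul (by fun_prop) (measurable_expNeg.comp (Measurable.const_mul ?_ _))
  have h2 : Measurable fun z : (Plane × Plane) × Mark =>
      1 - expNeg (factorExponent p (fun l => gCoeff p s θ (k l) (dist3 p z.1.1)) z.1.2 z.2) := by
    refine measurable_const.sub (measurable_expNeg.comp ?_)
    exact measurable_factorExponent_comp p
      (measurable_pi_lambda _ fun l => (hg l).comp (measurable_fst.comp measurable_fst))
      (measurable_snd.comp measurable_fst) measurable_snd
  exact (h2.lintegral_prod_right' (ν := markLaw p)).lintegral_prod_right'

variable {Ω : Type*} [MeasurableSpace Ω] {μ : Measure Ω} {X : ℕ → Ω → Plane}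
  {Y : Option ℕ → Ω → Mark}

omit hp hθ in
lemma IsNetwork.aemeasurable_momentTerm (hXY : IsNetwork p X Y μ) :
    AEMeasurable (fun ω => momentTerm p s θ k
      (Y none ω, (fun i => X i ω), fun i => Y (some i) ω)) μ := by
  have hm : Measurable fun z : (ℕ → Plane) × (Option ℕ → Mark) =>
      momentTerm p s θ k (z.2 none, z.1, fun i => z.2 (some i)) :=
    (measurable_momentTerm p s θ k).comp (by fun_prop)
  exact hm.comp_aemeasurable hXY.aemeasurable

variable [IsProbabilityMeasure μ]

/-- The expectation of one term of the expansion. -/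
lemma IsNetwork.integral_momentTerm (hXY : IsNetwork p X Y μ) :
    ∫ ω, (momentTerm p s θ k (Y none ω, (fun i => X i ω), fun i => Y (some i) ω)).toReal ∂μ =
      ∫ r in p.h..Real.sqrt (p.rc ^ 2 + p.h ^ 2),
        linkProb p s (Real.sqrt (r ^ 2 - p.h ^ 2)) *
          laplaceTerm p (fun i => gCoeff p s θ (k i) r) * distDensity p r := by
  have hh := hp.h_pos
  have hprob := isProbabilityMeasure_disc hp
  have hLT := measurable_ofReal_laplaceTerm hp (s := s) hθ k
  have hLT0 (v : Plane) : 0 ≤ laplaceTerm p fun l => gCoeff p s θ (k l) (dist3 p v) :=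
    mul_nonneg (Real.exp_nonneg _) (Real.exp_nonneg _)
  -- With the reference mark frozen, its distance and state are constants, and the rest is the
  -- Laplace functional of the marked process.
  have hinner (w : Mark) : ∫⁻ ω, ∫⁻ y, momentTerm p s θ k (w, (fun i => X i ω), y)
      ∂(Measure.infinitePi fun _ : ℕ => markLaw p) ∂μ =
      if linkState p w.1 w.2.1 = s then
        ENNReal.ofReal (laplaceTerm p fun l => gCoeff p s θ (k l) (dist3 p w.1)) else 0 := by
    unfold momentTerm
    by_cases hs : linkState p w.1 w.2.1 = s
    · have hφ : Measurable fun z : Plane × Mark =>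
          factorExponent p (fun l => gCoeff p s θ (k l) (dist3 p w.1)) z.1 z.2 :=
        measurable_factorExponent_comp p measurable_const measurable_fst measurable_snd
      simp only [if_pos hs]
      simp_rw [lintegral_const_mul' _ _ (ENNReal.ofReal_ne_top)]
      rw [hXY.lintegral_expNeg_marked hp hφ, ofReal_laplaceTerm hp
        fun l => gCoeff_nonneg hp s hθ _ (dist3_pos hp w.1)]
    · simp [hs]
  have hback (r : ℝ) (hr : p.h ≤ r) :
      Real.sqrt (Real.sqrt (r ^ 2 - p.h ^ 2) ^ 2 + p.h ^ 2) = r := by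
    rw [Real.sq_sqrt (by nlinarith), sub_add_cancel, Real.sqrt_sq (hh.le.trans hr)]
  have hle : p.h ≤ Real.sqrt (p.rc ^ 2 + p.h ^ 2) :=
    Real.le_sqrt_of_sq_le (by nlinarith [sq_nonneg p.rc])
  have hmeas : Measurable fun v : Plane => linkProb p s ‖v‖ *
      laplaceTerm p fun l => gCoeff p s θ (k l) (dist3 p v) := by
    refine ((measurable_linkProb p s).comp measurable_norm).mul ?_
    simpa only [ENNReal.toReal_ofReal (hLT0 _)] using hLT.ennreal_toReal
  have hval : ∫⁻ ω, momentTerm p s θ k (Y none ω, (fun i => X i ω), fun i => Y (some i) ω) ∂μ =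
      ∫⁻ v, ENNReal.ofReal (linkProb p s ‖v‖ *
        laplaceTerm p fun l => gCoeff p s θ (k l) (dist3 p v))
        ∂(ProbabilityTheory.cond volume (Metric.closedBall (0 : Plane) p.rc)) := by
    rw [hXY.lintegral_eq hp (measurable_momentTerm p s θ k), lintegral_congr hinner,
      lintegral_markLaw_own hp hLT]
    exact lintegral_congr fun v => (ENNReal.ofReal_mul (linkProb_nonneg hp s _)).symm
  rw [integral_toReal (hXY.aemeasurable_momentTerm k) (ae_of_all _ fun ω =>
    (momentTerm_le_one hp hθ k _).trans_lt ENNReal.one_lt_top), hval,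
    ← integral_eq_lintegral_of_nonneg_ae
      (ae_of_all _ fun v => mul_nonneg (linkProb_nonneg hp s _) (hLT0 v))
      hmeas.aestronglyMeasurable]
  refine (integral_disc_radial hp (fun t => linkProb p s t *
    laplaceTerm p fun l => gCoeff p s θ (k l) (Real.sqrt (t ^ 2 + p.h ^ 2)))).trans ?_
  refine intervalIntegral.integral_congr fun r hr => ?_
  rw [uIcc_of_le hle] at hr
  simp only [hback r hr.1]

lemma IsNetwork.integrable_momentTerm (hXY : IsNetwork p X Y μ) :
    Integrable (fun ω => (momentTerm p s θ k
      (Y none ω, (fun i => X i ω), fun i => Y (some i) ω)).toReal) μ := by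
  refine Integrable.of_bound
    (hXY.aemeasurable_momentTerm k).ennreal_toReal.aestronglyMeasurable 1
    (ae_of_all _ fun ω => ?_)
  rw [Real.norm_of_nonneg ENNReal.toReal_nonneg]
  exact ENNReal.toReal_le_of_le_ofReal zero_le_one (by simpa using momentTerm_le_one hp hθ k _)

omit k

lemma IsNetwork.integrable_approxSuccessOn_pow (hXY : IsNetwork p X Y μ) (hb : 1 ≤ b) :
    Integrable (fun ω => approxSuccessOn p s θ ⟨fun i => X i ω, fun i => Y i ω⟩ ^ b) μ := by
  simp_rw [approxSuccessOn_pow hp hθ hb]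
  exact integrable_finsetSum _ fun k _ => (hXY.integrable_momentTerm hp hθ k).const_mul _

/-- The explicit formula is the moment of the approximate conditional success probability. -/
theorem IsNetwork.integral_approxSuccessOn_pow (hXY : IsNetwork p X Y μ) (hb : 1 ≤ b) :
    ∫ ω, approxSuccessOn p s θ ⟨fun i => X i ω, fun i => Y i ω⟩ ^ b ∂μ =
      momentFormula p s b θ := by
  simp_rw [approxSuccessOn_pow hp hθ hb]
  rw [integral_finsetSum _ fun k _ => (hXY.integrable_momentTerm hp hθ k).const_mul _,
    momentFormula]
  refine Finset.sum_congr rfl fun k _ => ?_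
  rw [integral_const_mul, hXY.integral_momentTerm hp hθ k]

omit hθ in
lemma condSuccessOn_mem (x : Realization) : condSuccessOn p s θ x ∈ Icc 0 1 := by
  have := isProbabilityMeasure_gainLaw hp
  unfold condSuccessOn
  split_ifs
  · exact ⟨measureReal_nonneg, measureReal_le_one⟩
  · exact ⟨le_rfl, zero_le_one⟩

omit hθ in
lemma IsNetwork.integrable_condSuccessOn_pow (hXY : IsNetwork p X Y μ) :
    Integrable (fun ω => condSuccessOn p s θ ⟨fun i => X i ω, fun i => Y i ω⟩ ^ b) μ := by
  refine Integrable.of_bound (((measurable_condSuccessOn hp θ s).comp_aemeasurable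
    hXY.aemeasurable).pow_const b).aestronglyMeasurable 1 (ae_of_all _ fun ω => ?_)
  have h := condSuccessOn_mem hp (s := s) (θ := θ) ⟨fun i => X i ω, fun i => Y i ω⟩
  rw [Real.norm_of_nonneg (pow_nonneg h.1 _)]
  exact pow_le_one₀ h.1 h.2

omit hθ in
-- Exactly one of the two parts carries the success probability. The other contributes `0 ^ b`,
-- which vanishes because `b ≥ 1`.
theorem IsNetwork.moment_eq_add (hXY : IsNetwork p X Y μ) (hb : 1 ≤ b) :
    moment p b θ X Y μ = momentOn p .los b θ X Y μ + momentOn p .nlos b θ X Y μ := by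
  rw [moment, momentOn, momentOn, ← integral_add (hXY.integrable_condSuccessOn_pow hp)
    (hXY.integrable_condSuccessOn_pow hp)]
  congr 1 with ω
  have hb0 : b ≠ 0 := by omega
  unfold condSuccessOn
  cases Realization.ownState p ⟨fun i => X i ω, fun i => Y i ω⟩ none <;> simp [hb0]

end Moments

/-! ### From success probabilities to their moments -/

/-- On `[0, 1]` the map `t ↦ t ^ n` has Lipschitz constant `n`. The bound `c ≤ 1` is why the
approximation must be known not to exceed one. -/
lemma pow_le_pow_add_mul {a c d : ℝ} (ha : 0 ≤ a) (hac : a ≤ c) (hc : c ≤ 1) (hd : c ≤ a + d)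
    (n : ℕ) : c ^ n ≤ a ^ n + n * d := by
  induction n with
  | zero => simp
  | succ n ih =>
    have h1 : a ^ n ≤ 1 := pow_le_one₀ ha (hac.trans hc)
    have h2 : 0 ≤ a ^ n := pow_nonneg ha n
    have h3 : 0 ≤ c := ha.trans hac
    have h4 : 0 ≤ d := by linarith
    have h5 : 0 ≤ n * d := by positivity
    calc c ^ (n + 1) = c ^ n * c := pow_succ c n
      _ ≤ (a ^ n + n * d) * c := mul_le_mul_of_nonneg_right ih h3
      _ = a ^ n * c + n * d * c := by ring
      _ ≤ a ^ n * (a + d) + n * d * 1 := by gcongr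
      _ ≤ a ^ (n + 1) + ((n + 1 : ℕ) : ℝ) * d := by
        push_cast
        rw [pow_succ]
        nlinarith

end UavUplink

theorem lemma2 {Ω : Type*} [MeasurableSpace Ω] (μ : Measure Ω) [IsProbabilityMeasure μ]
    (p : UavUplink.Params) (hp : p.Admissible)
    (X : ℕ → Ω → UavUplink.Plane) (Y : Option ℕ → Ω → UavUplink.Mark)
    (hXY : UavUplink.IsNetwork p X Y μ)
    (θ : ℝ) (hθ : 0 < θ) (b : ℕ) (hb : 1 ≤ b) :
    UavUplink.moment p b θ X Y μ =
        UavUplink.momentOn p .los b θ X Y μ + UavUplink.momentOn p .nlos b θ X Y μ ∧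
      ∀ s : UavUplink.LinkState,
        ∫ ω, UavUplink.approxSuccessOn p s θ ⟨fun i => X i ω, fun i => Y i ω⟩ ^ b ∂μ =
            UavUplink.momentFormula p s b θ ∧
          UavUplink.momentOn p s b θ X Y μ ≤ UavUplink.momentFormula p s b θ ∧
          UavUplink.momentFormula p s b θ ≤
            UavUplink.momentOn p s b θ X Y μ + b * UavUplink.gammaTailError (p.m s) := by
  refine ⟨hXY.moment_eq_add hp hb, fun s => ?_⟩
  have hformula := hXY.integral_approxSuccessOn_pow hp (s := s) hθ hb
  have hi := hXY.integrable_approxSuccessOn_pow hp (s := s) hθ hb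
  have hi' := hXY.integrable_condSuccessOn_pow hp (s := s) (θ := θ) (b := b)
  have h0 (x : UavUplink.Realization) := (UavUplink.condSuccessOn_mem hp (s := s) (θ := θ) x).1
  have hcmp (x : UavUplink.Realization) := UavUplink.condSuccessOn_le_approxSuccessOn hp x hθ s
  refine ⟨hformula, ?_, ?_⟩
  · rw [← hformula]
    exact integral_mono hi' hi fun ω => pow_le_pow_left₀ (h0 _) (hcmp _).1 b
  · rw [← hformula]
    calc _ ≤ ∫ ω, (UavUplink.condSuccessOn p s θ ⟨fun i => X i ω, fun i => Y i ω⟩ ^ b +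
            b * UavUplink.gammaTailError (p.m s)) ∂μ :=
          integral_mono hi (hi'.add (integrable_const _)) fun ω =>
            UavUplink.pow_le_pow_add_mul (h0 _) (hcmp _).1 (hcmp _).2.2 (hcmp _).2.1 b
      _ = _ := by
        rw [integral_add hi' (integrable_const _)]
        simp [UavUplink.momentOn]
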